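/- Let $R$ and $S$ be commutative rings, let $I\subset R$ and $J\subset S$ be finitely generated ideals, and let $f\colon R\to S$ be a ring homomorphism with $f(I)\subset J$. Assume that $R$ is $I$-adically coherent, i.e., that the ring $R/I^n$ is coherent for every $n\ge1$. Assume also that $f\colon(R,I)\to(S,J)$ is quotflat, i.e., that there exist descending sequences of finitely generated ideals $I_1\supset I_2\supset\cdots$ in $R$ and $J_1\supset J_2\supset\cdots$ in $S$ such that for every $n\ge1$: $I_n\subset I^n$ and $J_n\subset J^n$; there is $q\ge n$ with $I^q\subset I_n$ and $J^q\subset J_n$; and $f(I_n)\subset J_n$ and $S/J_n$ is a flat $R/I_n$-module. An $S$-module $M$ is $J$-torsion if for all $s\in J$ and $x\in M$ there is $n\ge1$ with $s^nx=0$. An $S$-module $P$ is a $J$-contramodule if $\operatorname{Hom}_S(S[s^{-1}],P)=0=\operatorname{Ext}^1_S(S[s^{-1}],P)$ for all $s\in J$; it is quotseparated if, moreover, it is a quotient of a $J$-adically separated and complete $S$-module; and it is contraflat if the functor ${-}\otimes_SP$ is exact on the category of $J$-torsion $S$-modules. A $J$-torsion $S$-module $K$ is fp-injective (as a $J$-torsion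 module) if $\operatorname{Ext}^1(M,K)=0$ in the abelian category of $J$-torsion $S$-modules for all finitely presented objects $M$ of that category. The same definitions apply to $(R,I)$. Then the following hold. (a) Suppose that $I$ is weakly proregular, i.e., $I$ is generated by a finite sequence $\mathbf s=(s_1,\dots,s_m)$ such that for every $i>0$ the projective system of Koszul homology modules $(H_iK_\bullet(R,s_1^n,\dots,s_m^n))_{n\ge1}$ is pro-zero (for every $j\ge1$ there is $k>j$ for which the transition map from the $k$-th to the $j$-th term vanishes). Then every contraflat quotseparated $J$-contramodule $S$-module is, by restriction of scalars along $f$, also a contraflat $I$-contramodule $R$-module. (b) Every fp-injective $J$-torsion $S$-module is, by restriction of scalars along $f$, also an fp-injective $I$-torsion $R$-module. (Here weak proregularity of $I$ is not needed.) -/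

import Mathlib

open CategoryTheory TensorProduct

universe u

noncomputable section

/-! ### Koszul complexes and weak proregularity -/

namespace Koszul

variable {R : Type u} [CommRing R] {m : ℕ}

/-- The linear functional on `R ^ m` sending the `a`-th basis vector to `t a`. -/
def functional (t : Fin m → R) : Module.Dual R (Fin m → R) :=
  ∑ a, t a • LinearMap.proj a

/-- The Koszul differential of the sequence `t`, on the exterior algebra of `R ^ m`:
`e_{a_1} ∧ ⋯ ∧ e_{a_i} ↦ ∑ (-1) ^ (j - 1) t_{a_j} e_{a_1} ∧ ⋯ (no e_{a_j}) ⋯ ∧ e_{a_i}`.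
The Koszul complex `K_•(R, t)`, the tensor product of the two-term complexes `t a : R → R`,
is `⋀[R]^i (R ^ m)` in homological degree `i`. -/
def d (t : Fin m → R) :
    ExteriorAlgebra R (Fin m → R) →ₗ[R] ExteriorAlgebra R (Fin m → R) :=
  CliffordAlgebra.contractLeft (functional t)

theorem d_ι_mul (t : Fin m → R) (v : Fin m → R) (x : ExteriorAlgebra R (Fin m → R)) :
    d t (ExteriorAlgebra.ι R v * x) =
      functional t v • x - ExteriorAlgebra.ι R v * d t x :=
  CliffordAlgebra.contractLeft_ι_mul _ _ _

theorem d_d (t : Fin m → R) (x : ExteriorAlgebra R (Fin m → R)) : d t (d t x) = 0 :=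
  CliffordAlgebra.contractLeft_contractLeft _ _

theorem d_mem (t : Fin m → R) (i : ℕ) :
    ∀ x ∈ ⋀[R]^(i + 1) (Fin m → R), d t x ∈ ⋀[R]^i (Fin m → R) := by
  induction i with
  | zero =>
    intro x hx
    rw [ExteriorAlgebra.exteriorPower, zero_add, pow_one] at hx
    obtain ⟨v, rfl⟩ := hx
    rw [ExteriorAlgebra.exteriorPower, pow_zero, Submodule.mem_one]
    exact ⟨functional t v, (CliffordAlgebra.contractLeft_ι (0 : QuadraticForm R (Fin m → R)) (functional t) v).symm⟩
  | succ i ih =>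
    intro x hx
    rw [ExteriorAlgebra.exteriorPower, pow_succ'] at hx
    induction hx using Submodule.mul_induction_on' with
    | mem_mul_mem a ha b hb =>
      obtain ⟨v, rfl⟩ := ha
      rw [d_ι_mul]
      refine Submodule.sub_mem _ (Submodule.smul_mem _ _ hb) ?_
      rw [ExteriorAlgebra.exteriorPower, pow_succ']
      exact Submodule.mul_mem_mul ⟨v, rfl⟩ (ih b hb)
    | add a _ b _ ha hb =>
      rw [map_add]
      exact Submodule.add_mem _ ha hb

/-- The `i`-cycles of the Koszul complex. -/
def cycles (t : Fin m → R) (i : ℕ) : Submodule R (ExteriorAlgebra R (Fin m → R)) :=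
  ⋀[R]^i (Fin m → R) ⊓ LinearMap.ker (d t)

/-- The `i`-boundaries of the Koszul complex. -/
def boundaries (t : Fin m → R) (i : ℕ) : Submodule R (ExteriorAlgebra R (Fin m → R)) :=
  (⋀[R]^(i + 1) (Fin m → R)).map (d t)

theorem boundaries_le_cycles (t : Fin m → R) (i : ℕ) : boundaries t i ≤ cycles t i := by
  rintro _ ⟨x, hx, rfl⟩
  exact ⟨d_mem t i x hx, d_d t x⟩

/-- The Koszul homology module `H_i K_•(R, t)`. -/
abbrev homology (t : Fin m → R) (i : ℕ) : Type u :=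
  ↥(cycles t i) ⧸ (boundaries t i).submoduleOf (cycles t i)

/-- The diagonal endomorphism of `R ^ m` with entries `c a`. -/
def diagonal (c : Fin m → R) : (Fin m → R) →ₗ[R] (Fin m → R) :=
  LinearMap.pi fun a => c a • LinearMap.proj a

/-- The transition map `K_•(R, s ^ k) → K_•(R, s ^ j)`, `j ≤ k`: the tensor product of the maps
which are the identity in degree `0` and multiplication by `s a ^ (k - j)` in degree `1`. -/
def transition (s : Fin m → R) (j k : ℕ) :
    ExteriorAlgebra R (Fin m → R) →ₐ[R] ExteriorAlgebra R (Fin m → R) :=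
  ExteriorAlgebra.map (diagonal (fun a => s a ^ (k - j)))

theorem transition_mem (s : Fin m → R) (j k i : ℕ) {x : ExteriorAlgebra R (Fin m → R)}
    (hx : x ∈ ⋀[R]^i (Fin m → R)) : transition s j k x ∈ ⋀[R]^i (Fin m → R) := by
  have h : Submodule.map (transition s j k).toLinearMap (⋀[R]^i (Fin m → R)) ≤
      ⋀[R]^i (Fin m → R) := by
    rw [Submodule.map_pow]
    refine pow_le_pow_left' ?_ i
    rintro _ ⟨_, ⟨v, rfl⟩, rfl⟩
    exact ⟨_, (ExteriorAlgebra.map_apply_ι _ v).symm⟩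
  exact h ⟨x, hx, rfl⟩

theorem d_transition (s : Fin m → R) {j k : ℕ} (hjk : j ≤ k)
    (x : ExteriorAlgebra R (Fin m → R)) :
    d (s ^ j) (transition s j k x) = transition s j k (d (s ^ k) x) := by
  induction x using CliffordAlgebra.left_induction with
  | algebraMap r =>
    rw [AlgHom.commutes]
    erw [CliffordAlgebra.contractLeft_algebraMap, CliffordAlgebra.contractLeft_algebraMap]
    rw [map_zero]
  | add x y hx hy => simp only [map_add, hx, hy]
  | ι_mul x v hx =>
    have h1 : transition s j k (ExteriorAlgebra.ι R v) = ExteriorAlgebra.ι R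
        (diagonal (fun a => s a ^ (k - j)) v) :=
      ExteriorAlgebra.map_apply_ι _ v
    have h2 : functional (s ^ j)
        (diagonal (fun a => s a ^ (k - j)) v) =
        functional (s ^ k) v := by
      simp only [functional, diagonal, LinearMap.sum_apply, LinearMap.smul_apply, LinearMap.proj_apply,
        LinearMap.pi_apply, smul_eq_mul, Pi.pow_apply]
      refine Finset.sum_congr rfl fun a _ => ?_
      rw [← mul_assoc, ← pow_add, Nat.add_sub_cancel' hjk]
    change d (s ^ j) (transition s j k (ExteriorAlgebra.ι R v * x)) =
      transition s j k (d (s ^ k) (ExteriorAlgebra.ι R v * x))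
    rw [map_mul, h1, d_ι_mul, d_ι_mul, map_sub, map_smul, map_mul, h1, h2, hx]

theorem transition_mem_cycles (s : Fin m → R) {j k : ℕ} (hjk : j ≤ k) (i : ℕ) :
    ∀ x ∈ cycles (s ^ k) i, (transition s j k).toLinearMap x ∈ cycles (s ^ j) i := by
  rintro x ⟨hx, hx'⟩
  refine ⟨transition_mem s j k i hx, ?_⟩
  have hx'' : d (s ^ k) x = 0 := hx'
  change d (s ^ j) (transition s j k x) = 0
  rw [d_transition s hjk, hx'', map_zero]

/-- The map `H_i K_•(R, s ^ k) → H_i K_•(R, s ^ j)` induced by the transition map. -/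
def homologyMap (s : Fin m → R) {j k : ℕ} (hjk : j ≤ k) (i : ℕ) :
    homology (s ^ k) i →ₗ[R] homology (s ^ j) i :=
  Submodule.mapQ _ _
    ((transition s j k).toLinearMap.restrict (transition_mem_cycles s hjk i)) (by
      rintro ⟨_, _⟩ ⟨y, hy, rfl⟩
      exact ⟨transition s j k y, transition_mem s j k (i + 1) hy, d_transition s hjk y⟩)

end Koszul

/-- A finite sequence is weakly proregular if the projective systems
`(H_i K_•(R, s ^ n))_{n ≥ 1}` are pro-zero for all `i > 0`. -/
def IsWeaklyProregularSeq {R : Type u} [CommRing R] {m : ℕ} (s : Fin m → R) : Prop :=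
  ∀ i : ℕ, 0 < i → ∀ j : ℕ, 1 ≤ j →
    ∃ (k : ℕ) (h : j < k), Koszul.homologyMap s h.le i = 0

/-- An ideal is weakly proregular if it is generated by a weakly proregular finite sequence
(the choice of a finite sequence of generators is known not to matter). -/
def IsWeaklyProregular {R : Type u} [CommRing R] (I : Ideal R) : Prop :=
  ∃ (m : ℕ) (s : Fin m → R), Ideal.span (Set.range s) = I ∧ IsWeaklyProregularSeq s

/-! ### Adic coherence and quotflatness -/

/-- A commutative ring is coherent if its finitely generated ideals are finitely presented. -/
def IsCoherentRing (A : Type u) [CommRing A] : Prop :=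
  ∀ K : Ideal A, K.FG → Module.FinitePresentation A K

def IsAdicallyCoherent {R : Type u} [CommRing R] (I : Ideal R) : Prop :=
  ∀ n : ℕ, 1 ≤ n → IsCoherentRing (R ⧸ I ^ n)

/-- Quotflatness of a morphism of pairs `f : (R, I) → (S, J)`. -/
def IsQuotflat {R S : Type u} [CommRing R] [CommRing S] (f : R →+* S)
    (I : Ideal R) (J : Ideal S) : Prop :=
  ∃ (I' : ℕ → Ideal R) (J' : ℕ → Ideal S),
    (∀ n, 1 ≤ n → (I' n).FG ∧ (J' n).FG) ∧
    (∀ n, 1 ≤ n → I' (n + 1) ≤ I' n ∧ J' (n + 1) ≤ J' n) ∧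
    (∀ n, 1 ≤ n → I' n ≤ I ^ n ∧ J' n ≤ J ^ n) ∧
    (∀ n, 1 ≤ n → ∃ q, n ≤ q ∧ I ^ q ≤ I' n ∧ J ^ q ≤ J' n) ∧
    (∀ n, 1 ≤ n → ∃ h : I' n ≤ (J' n).comap f, (Ideal.quotientMap (J' n) f h).Flat)

/-! ### Torsion modules -/

/-- `M` is `I`-torsion: every element of `M` is annihilated by a power of each `s ∈ I`. -/
def IsTorsionModule {R : Type u} [CommRing R] (I : Ideal R)
    (M : Type u) [AddCommGroup M] [Module R M] : Prop :=
  ∀ s ∈ I, ∀ x : M, ∃ n : ℕ, 1 ≤ n ∧ s ^ n • x = 0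

/-- The property of being `I`-torsion, on the category of `R`-modules. -/
def torsionProperty {R : Type u} [CommRing R] (I : Ideal R) : ObjectProperty (ModuleCat.{u} R) :=
  fun M => IsTorsionModule I M

/-- The category of `I`-torsion `R`-modules. -/
abbrev TorsionModuleCat {R : Type u} [CommRing R] (I : Ideal R) : Type (u + 1) :=
  (torsionProperty I).FullSubcategory

/-- Torsion modules form a Serre class; hence `TorsionModuleCat I` is an abelian category. -/
instance torsionProperty_isSerreClass {R : Type u} [CommRing R] (I : Ideal R) :
    (torsionProperty I).IsSerreClass where
  exists_zero := ⟨ModuleCat.of R PUnit, ModuleCat.isZero_of_subsingleton _,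
    fun _ _ _ => ⟨1, le_rfl, Subsingleton.elim _ _⟩⟩
  prop_of_mono {M N} f hf hN := by
    rw [ModuleCat.mono_iff_injective] at hf
    intro s hs x
    obtain ⟨n, hn, h⟩ := hN s hs (f x)
    exact ⟨n, hn, hf (by rw [map_smul, h, map_zero])⟩
  prop_of_epi {M N} f hf hM := by
    rw [ModuleCat.epi_iff_surjective] at hf
    intro s hs y
    obtain ⟨x, rfl⟩ := hf y
    obtain ⟨n, hn, h⟩ := hM s hs x
    exact ⟨n, hn, by rw [← map_smul, h, map_zero]⟩
  prop_X₂_of_shortExact {X} hX h₁ h₃ := by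
    intro s hs x
    obtain ⟨n, hn, h⟩ := h₃ s hs (X.g x)
    have hex := (ShortComplex.moduleCat_exact_iff X).1 hX.exact (s ^ n • x)
      (by rw [map_smul, h])
    obtain ⟨y, hy⟩ := hex
    obtain ⟨k, hk, h'⟩ := h₁ s hs y
    exact ⟨k + n, by omega, by rw [pow_add, mul_smul, ← hy, ← map_smul, h', map_zero]⟩

instance torsionProperty_isClosedUnderFiniteProducts {R : Type u} [CommRing R] (I : Ideal R) :
    (torsionProperty I).IsClosedUnderFiniteProducts where
  isClosedUnderLimitsOfShape T _ :=
    { limitsOfShape_le := by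
        rintro X ⟨p⟩ s hs x
        choose n hn h using fun t : T => p.prop_diag_obj ⟨t⟩ s hs (p.π.app ⟨t⟩ x)
        cases nonempty_fintype T
        refine ⟨1 + Finset.univ.sup n, by omega, ?_⟩
        refine Limits.Concrete.isLimit_ext p.diag p.isLimit _ _ ?_
        rintro ⟨t⟩
        change p.π.app ⟨t⟩ (s ^ (1 + Finset.univ.sup n) • x) = p.π.app ⟨t⟩ 0
        have hle : n t ≤ 1 + Finset.univ.sup n :=
          (Finset.le_sup (f := n) (Finset.mem_univ t)).trans (Nat.le_add_left _ _)
        rw [map_smul, map_zero, ← Nat.sub_add_cancel hle, pow_add, mul_smul, h t, smul_zero] }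

instance torsionModuleCatAbelian {R : Type u} [CommRing R] (I : Ideal R) :
    Abelian (TorsionModuleCat I) :=
  haveI : (torsionProperty I).IsClosedUnderCokernels := inferInstance
  inferInstance

instance torsionModuleCatHasExt {R : Type u} [CommRing R] (I : Ideal R) :
    HasExt.{u + 1} (TorsionModuleCat I) :=
  HasExt.standard _

/-- `K` is an fp-injective `I`-torsion `R`-module: it is `I`-torsion, and `Ext¹(M, K) = 0` in the
abelian category of `I`-torsion `R`-modules for all finitely presented objects `M` of that
category. -/
def IsFpInjectiveTorsion {R : Type u} [CommRing R] (I : Ideal R)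
    (K : Type u) [AddCommGroup K] [Module R K] : Prop :=
  ∃ hK : IsTorsionModule I K, ∀ M : TorsionModuleCat I, IsFinitelyPresentable.{u} M →
    Subsingleton (Abelian.Ext M (⟨ModuleCat.of R K, hK⟩ : TorsionModuleCat I) 1)

/-! ### Contramodules -/

/-- `P` is a `J`-contramodule: `Hom(S[s⁻¹], P) = 0 = Ext¹(S[s⁻¹], P)` for all `s ∈ J`. -/
def IsContramodule {S : Type u} [CommRing S] (J : Ideal S)
    (P : Type u) [AddCommGroup P] [Module S P] : Prop :=
  ∀ s ∈ J, Subsingleton (Localization.Away s →ₗ[S] P) ∧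
    Subsingleton
      (Abelian.Ext (ModuleCat.of S (Localization.Away s)) (ModuleCat.of S P) 1)

/-- A quotseparated `J`-contramodule: a `J`-contramodule that is a quotient module of
a `J`-adically separated and complete module. -/
def IsQuotseparatedContramodule {S : Type u} [CommRing S] (J : Ideal S)
    (P : Type u) [AddCommGroup P] [Module S P] : Prop :=
  IsContramodule J P ∧
    ∃ (C : Type u) (_ : AddCommGroup C) (_ : Module S C) (g : C →ₗ[S] P),
      IsAdicComplete J C ∧ Function.Surjective g

/-- `F` is a contraflat `J`-contramodule: it is a `J`-contramodule, and the functor `- ⊗ F` is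
exact on the category of `J`-torsion modules. -/
def IsContraflat {S : Type u} [CommRing S] (J : Ideal S)
    (F : Type u) [AddCommGroup F] [Module S F] : Prop :=
  IsContramodule J F ∧
    ∀ (A B C : Type u) [AddCommGroup A] [AddCommGroup B] [AddCommGroup C]
      [Module S A] [Module S B] [Module S C] (f : A →ₗ[S] B) (g : B →ₗ[S] C),
      IsTorsionModule J A → IsTorsionModule J B → IsTorsionModule J C →
      Function.Injective f → Function.Exact f g → Function.Surjective g →
      Function.Injective (f.rTensor F) ∧ Function.Exact (f.rTensor F) (g.rTensor F) ∧
        Function.Surjective (g.rTensor F)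

end

noncomputable section

/-! ### Extension and lifting criteria for the vanishing of `Ext¹` -/

namespace CategoryTheory.Abelian.Ext

universe w v u'

variable {C : Type u'} [Category.{v} C] [Abelian C] [HasExt.{w} C]

/-! Both halves transport a finite-level fact, flatness of `R/I'_m → S/J'_m`, to a module living
over all levels at once.

(a) The resolution of `S[s⁻¹]` by `1 - sX` on `S[X]` turns the contramodule condition into
bijectivity of `shiftMap`, which depends only on how `s` acts and so survives restriction of
scalars. A finitely generated submodule of a torsion module is killed by a power of `I`, so
contraflatness follows once every `F/IⁿF` is flat over `R/Iⁿ`; this is used in the equational form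
`FlatModulo`. Let `∑ rᵢxᵢ ∈ IⁿF`. Coherence provides a finite matrix `M` over `R` whose columns
generate the vectors `v` with `∑ vᵢrᵢ ∈ Iⁿ`, and it suffices to solve `My = x` in `F`. Since
`F/J'_mF` is flat over `S/J'_m`, hence over `R/I'_m`, the equation is solvable modulo every `Jᵏ`. A
Mittag-Leffler argument shows that the image of `M` is closed: vectors nearly killed by `M` are
close to vectors killed by `M`, because over `R` the image of `M` contains all vectors with entries
in `Iⁿ` (`IsQuotflat.mem_range_matrixMap`). This requires `F` to be `J`-adically complete and
separated. Completeness passes to quotients. For separatedness, `D = ⋂ JⁿF` satisfies `D = JD` by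
contraflatness, and it is a contramodule, so it vanishes by Nakayama's lemma.

(b) The finitely presented torsion objects are the torsion modules finitely presented over the ring.
Embedding `K` into an injective torsion module reduces the vanishing of `Ext¹` to extending maps `φ
: N → K` to a finitely generated torsion `L ⊇ N` with `L/N` finitely presented. For large `m` the
ideal `I'_m` kills `L` and `J'_m` kills the `S`-span of `φ(N)`. Tensoring with `S/J'_m` then keeps
`N → L` injective, and fp-injectivity over `S` extends the induced map, which restricts to an
extension of `φ`. -/

theorem exists_extension_of_subsingleton {X : ShortComplex C} (hX : X.ShortExact) {Y : C}
    [Subsingleton (Ext X.X₃ Y 1)] (f : X.X₁ ⟶ Y) : ∃ g : X.X₂ ⟶ Y, X.f ≫ g = f := by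
  obtain ⟨x, hx⟩ := Ext.contravariant_sequence_exact₁ hX Y (mk₀ f) (add_zero 1)
    (Subsingleton.elim _ _)
  obtain ⟨g, rfl⟩ := mk₀_bijective _ _ |>.2 x
  exact ⟨g, (mk₀_bijective _ _).1 (by rw [← hx, mk₀_comp_mk₀])⟩

theorem subsingleton_of_exists_extension {X : ShortComplex C} (hX : X.ShortExact) {Y : C}
    [Subsingleton (Ext X.X₂ Y 1)] (h : ∀ f : X.X₁ ⟶ Y, ∃ g : X.X₂ ⟶ Y, X.f ≫ g = f) :
    Subsingleton (Ext X.X₃ Y 1) := by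
  refine subsingleton_of_forall_eq 0 fun e => ?_
  obtain ⟨x, rfl⟩ := Ext.contravariant_sequence_exact₃ hX Y e (Subsingleton.elim _ _) (add_zero 1)
  obtain ⟨f, rfl⟩ := mk₀_bijective _ _ |>.2 x
  obtain ⟨g, rfl⟩ := h f
  rw [← mk₀_comp_mk₀, ShortComplex.ShortExact.extClass_comp_assoc]

/-- The middle `Ext¹` vanishes, so each class is the connecting image of a map to `X.X₃`; the
connecting map kills maps that lift. -/
theorem subsingleton_of_exists_lift {X : ShortComplex C} (hX : X.ShortExact) {Y : C}
    [Subsingleton (Ext Y X.X₂ 1)] (h : ∀ f : Y ⟶ X.X₃, ∃ g : Y ⟶ X.X₂, g ≫ X.g = f) :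
    Subsingleton (Ext Y X.X₁ 1) := by
  refine subsingleton_of_forall_eq 0 fun e => ?_
  obtain ⟨x, rfl⟩ := Ext.covariant_sequence_exact₁ Y hX e (Subsingleton.elim _ _) (zero_add 1)
  obtain ⟨f, rfl⟩ := mk₀_bijective _ _ |>.2 x
  obtain ⟨g, rfl⟩ := h f
  rw [← mk₀_comp_mk₀, comp_assoc_of_second_deg_zero, hX.comp_extClass, comp_zero]

end CategoryTheory.Abelian.Ext

/-! ### An elementary description of contramodules -/

section Shift

variable {R : Type*} [CommRing R] (s : R) (P : Type*) [AddCommGroup P] [Module R P]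

/-- The map `b ↦ (b n - s b (n + 1))ₙ` on sequences. -/
def shiftMap : (ℕ → P) →ₗ[R] (ℕ → P) :=
  LinearMap.id - s • LinearMap.funLeft R P Nat.succ

variable {P}

@[simp]
theorem shiftMap_apply (b : ℕ → P) (n : ℕ) : shiftMap s P b n = b n - s • b (n + 1) := rfl

end Shift

section Resolution

open Polynomial

variable {S : Type u} [CommRing S] (s : S)

theorem mul_one_sub_C_mul_X_injective :
    Function.Injective (LinearMap.mulLeft S (1 - C s * X : S[X])) := by
  rw [injective_iff_map_eq_zero]
  intro p hp
  rw [LinearMap.mulLeft_apply, sub_mul, one_mul, sub_eq_zero, mul_assoc] at hp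
  ext n
  induction n with
  | zero => rw [hp]; simp
  | succ n ih => rw [hp, coeff_C_mul, coeff_X_mul, ih]; simp

/-- The projection `S[X] → S[s⁻¹]` sending `X` to `s⁻¹`. -/
def awayProjection : S[X] →ₗ[S] Localization.Away s :=
  (Localization.awayEquivAdjoin s).symm.toLinearMap ∘ₗ
    (AdjoinRoot.mkₐ (C s * X - 1)).toLinearMap

theorem awayProjection_surjective : Function.Surjective (awayProjection s) :=
  (Localization.awayEquivAdjoin s).symm.surjective.comp AdjoinRoot.mk_surjective

theorem awayProjection_exact :
    Function.Exact (LinearMap.mulLeft S (1 - C s * X : S[X])) (awayProjection s) := by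
  intro p
  have h : awayProjection s p = 0 ↔ AdjoinRoot.mk (C s * X - 1) p = 0 :=
    (Localization.awayEquivAdjoin s).symm.map_eq_zero_iff
  rw [h, AdjoinRoot.mk_eq_zero]
  constructor
  · rintro ⟨q, rfl⟩
    -- The sign reconciles `1 - sX` here with the polynomial `sX - 1` defining the `AdjoinRoot`
    -- model.
    exact ⟨-q, by simp only [LinearMap.mulLeft_apply]; ring⟩
  · rintro ⟨q, rfl⟩
    exact ⟨-q, by simp only [LinearMap.mulLeft_apply]; ring⟩

variable {P : Type u} [AddCommGroup P] [Module S P]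

/-- Linear maps out of `S[X]` are sequences. -/
def polynomialHomEquiv : (S[X] →ₗ[S] P) ≃ (ℕ → P) :=
  ((Polynomial.basisMonomials S).constr S).symm.toEquiv

theorem polynomialHomEquiv_apply (f : S[X] →ₗ[S] P) (n : ℕ) :
    polynomialHomEquiv f n = f (monomial n 1) := by
  simp [polynomialHomEquiv, Module.Basis.constr]

theorem polynomialHomEquiv_comp (f : S[X] →ₗ[S] P) :
    polynomialHomEquiv (f ∘ₗ LinearMap.mulLeft S (1 - C s * X : S[X])) =
      shiftMap s P (polynomialHomEquiv f) := by
  funext n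
  rw [shiftMap_apply]
  simp only [polynomialHomEquiv_apply, LinearMap.comp_apply, LinearMap.mulLeft_apply]
  rw [← map_smul, ← map_sub]
  congr 1
  rw [sub_mul, one_mul, mul_assoc, X_mul_monomial, C_mul_monomial, smul_monomial, smul_eq_mul]

/-- `S[X]` is free, so the long exact sequence of `0 → S[X] → S[X] → S[s⁻¹] → 0` identifies `Hom`
and `Ext¹` with the kernel and cokernel of `shiftMap`. -/
theorem shiftMap_bijective_iff :
    (Subsingleton (Localization.Away s →ₗ[S] P) ∧
      Subsingleton
        (Abelian.Ext (ModuleCat.of S (Localization.Away s)) (ModuleCat.of S P) 1)) ↔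
      Function.Bijective (shiftMap s P) := by
  let X : ShortComplex (ModuleCat.{u} S) :=
    ShortComplex.mk (ModuleCat.ofHom (LinearMap.mulLeft S (1 - C s * X : S[X])))
      (ModuleCat.ofHom (awayProjection s)) (by
        ext1
        exact LinearMap.ext (awayProjection_exact s).apply_apply_eq_zero)
  have hX : X.ShortExact :=
    { exact := (ShortComplex.ShortExact.moduleCat_exact_iff_function_exact X).2
        (awayProjection_exact s)
      mono_f := (ModuleCat.mono_iff_injective _).2 (mul_one_sub_C_mul_X_injective s)
      epi_g := (ModuleCat.epi_iff_surjective _).2 (awayProjection_surjective s) }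
  have : Projective X.X₂ := ModuleCat.projective_of_free (Polynomial.basisMonomials S)
  have : Subsingleton (Abelian.Ext X.X₂ (ModuleCat.of S P) 1) :=
    Abelian.Ext.subsingleton_of_projective _ _ 0
  constructor
  · rintro ⟨h₀, h₁⟩
    constructor
    · rw [injective_iff_map_eq_zero]
      intro b hb
      obtain ⟨f, rfl⟩ := polynomialHomEquiv (S := S).surjective b
      rw [← polynomialHomEquiv_comp] at hb
      have hf : f ∘ₗ LinearMap.mulLeft S (1 - C s * Polynomial.X : S[X]) = 0 :=
        polynomialHomEquiv.injective (hb.trans (by funext n; simp [polynomialHomEquiv_apply]))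
      have hker : LinearMap.ker (awayProjection s) ≤ LinearMap.ker f := by
        intro x hx
        obtain ⟨y, rfl⟩ := (awayProjection_exact s x).1 hx
        exact LinearMap.congr_fun hf y
      let e := (awayProjection s).quotKerEquivOfSurjective (awayProjection_surjective s)
      have h := Subsingleton.elim ((Submodule.liftQ _ f hker) ∘ₗ e.symm.toLinearMap) 0
      have hf0 : f = 0 := by
        refine LinearMap.ext fun x => ?_
        have := DFunLike.congr_fun h (awayProjection s x)
        have he : e.symm (awayProjection s x) = Submodule.Quotient.mk x := by
          rw [LinearEquiv.symm_apply_eq]; rfl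
        simpa [he] using this
      rw [hf0]
      funext n
      simp [polynomialHomEquiv_apply]
    · intro a
      obtain ⟨f, rfl⟩ := polynomialHomEquiv (S := S).surjective a
      have : Subsingleton (Abelian.Ext X.X₃ (ModuleCat.of S P) 1) := h₁
      obtain ⟨g, hg⟩ := Abelian.Ext.exists_extension_of_subsingleton hX (ModuleCat.ofHom f)
      refine ⟨polynomialHomEquiv g.hom, ?_⟩
      rw [← polynomialHomEquiv_comp]
      exact congrArg (fun h => polynomialHomEquiv (ModuleCat.Hom.hom h)) hg
  · rintro ⟨h₀, h₁⟩
    constructor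
    · refine subsingleton_of_forall_eq 0 fun f => ?_
      have h : polynomialHomEquiv (f ∘ₗ awayProjection s) = 0 := by
        apply h₀
        rw [← polynomialHomEquiv_comp, map_zero]
        funext n
        rw [polynomialHomEquiv_apply]
        simp only [LinearMap.comp_apply]
        rw [(awayProjection_exact s).apply_apply_eq_zero, map_zero, Pi.zero_apply]
      have h' : f ∘ₗ awayProjection s = 0 :=
        polynomialHomEquiv.injective (h.trans (by funext n; simp [polynomialHomEquiv_apply]))
      ext1 x
      obtain ⟨y, rfl⟩ := awayProjection_surjective s x
      exact LinearMap.congr_fun h' y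
    · refine Abelian.Ext.subsingleton_of_exists_extension hX fun f => ?_
      obtain ⟨b, hb⟩ := h₁ (polynomialHomEquiv f.hom)
      obtain ⟨g, rfl⟩ := polynomialHomEquiv (S := S).surjective b
      rw [← polynomialHomEquiv_comp] at hb
      exact ⟨ModuleCat.ofHom g, ModuleCat.hom_ext (polynomialHomEquiv.injective hb)⟩

theorem isContramodule_iff {J : Ideal S} :
    IsContramodule J P ↔ ∀ s ∈ J, Function.Bijective (shiftMap s P) :=
  forall₂_congr fun s _ => shiftMap_bijective_iff s

end Resolution

/-! ### Nakayama's lemma for contramodules -/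

section Nakayama

variable {S : Type*} [CommRing S]

/-- Injectivity is inherited from the target of `h`, surjectivity from its source. -/
theorem shiftMap_bijective_range {s : S} {P Q : Type*} [AddCommGroup P] [Module S P]
    [AddCommGroup Q] [Module S Q] (h : P →ₗ[S] Q)
    (hP : Function.Bijective (shiftMap s P)) (hQ : Function.Bijective (shiftMap s Q)) :
    Function.Bijective (shiftMap s (LinearMap.range h)) := by
  constructor
  · intro a b hab
    have : shiftMap s Q (fun n => (a n : Q)) = shiftMap s Q (fun n => (b n : Q)) := by
      funext n
      exact congrArg Subtype.val (congrFun hab n)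
    funext n
    exact Subtype.ext (congrFun (hQ.1 this) n)
  · intro a
    choose p hp using fun n => (a n).2
    obtain ⟨b, hb⟩ := hP.2 p
    refine ⟨fun n => ⟨h (b n), b n, rfl⟩, funext fun n => Subtype.ext ?_⟩
    rw [← hp n, ← hb]
    simp

theorem shiftMap_bijective_quotient {s : S} {P : Type*} [AddCommGroup P] [Module S P]
    (N : Submodule S P) (hP : Function.Bijective (shiftMap s P))
    (hN : Function.Surjective (shiftMap s N)) :
    Function.Bijective (shiftMap s (P ⧸ N)) := by
  constructor
  · rw [injective_iff_map_eq_zero]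
    intro b hb
    choose p hp using fun n => N.mkQ_surjective (b n)
    have hpN : ∀ n, shiftMap s P p n ∈ N := by
      intro n
      rw [← Submodule.ker_mkQ N, LinearMap.mem_ker, shiftMap_apply, map_sub, map_smul, hp, hp]
      exact congrFun hb n
    obtain ⟨c, hc⟩ := hN fun n => ⟨_, hpN n⟩
    have : p = fun n => (c n : P) := hP.1 (by
      funext n
      exact (congrArg Subtype.val (congrFun hc n)).symm)
    funext n
    rw [← hp n, this]
    simp
  · intro a
    choose p hp using fun n => N.mkQ_surjective (a n)
    obtain ⟨b, hb⟩ := hP.2 p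
    refine ⟨fun n => N.mkQ (b n), funext fun n => ?_⟩
    rw [← hp n, ← hb]
    simp

/-- Dividing `x` by `s` repeatedly gives a sequence with `xₙ = s xₙ₊₁`, an element of the kernel of
`shiftMap` starting at `x`. -/
theorem subsingleton_of_shiftMap_injective {s : S} {P : Type*} [AddCommGroup P] [Module S P]
    (hP : Function.Injective (shiftMap s P)) (hs : Function.Surjective fun x : P => s • x) :
    Subsingleton P := by
  refine subsingleton_of_forall_eq 0 fun x => ?_
  choose g hg using hs
  have h : (fun n => g^[n] x) = (0 : ℕ → P) := by
    apply hP
    rw [map_zero]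
    funext n
    rw [shiftMap_apply, Function.iterate_succ_apply', Pi.zero_apply, sub_eq_zero]
    exact (hg _).symm
  exact congrFun h 0

/-- Induction on the number of generators: the quotient by `t 0 • v` inherits all hypotheses for the
remaining generators, so it vanishes; then `t 0` acts surjectively. -/
theorem subsingleton_of_span_smul_top_eq_top {v : Type*} [AddCommGroup v] [Module S v]
    {m : ℕ} (t : Fin m → S)
    (hP : ∀ i, Function.Bijective (shiftMap (t i) v))
    (ht : Ideal.span (Set.range t) • (⊤ : Submodule S v) = ⊤) : Subsingleton v := by
  induction m generalizing v with
  | zero =>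
    rw [Set.range_eq_empty, Ideal.span_empty, Submodule.bot_smul] at ht
    exact subsingleton_of_bot_eq_top ht |> fun h => (Submodule.subsingleton_iff S).1 h
  | succ m ih =>
    let N : Submodule S v := LinearMap.range (LinearMap.lsmul S v (t 0))
    have hN (i) : Function.Bijective (shiftMap (t i) N) :=
      shiftMap_bijective_range _ (hP i) (hP i)
    have hq : Subsingleton (v ⧸ N) := by
      refine ih (fun i => t i.succ)
        (fun i => shiftMap_bijective_quotient N (hP _) (hN _).2) ?_
      have h := congrArg (Submodule.map N.mkQ) ht
      rw [Submodule.map_smul'', Submodule.map_top, Submodule.range_mkQ] at h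
      rw [eq_top_iff]
      conv_lhs => rw [← h]
      rw [Submodule.smul_le]
      intro r hr x _
      induction hr using Submodule.span_induction with
      | mem r hr =>
        obtain ⟨i, rfl⟩ := hr
        refine Fin.cases ?_ (fun i => ?_) i
        · obtain ⟨y, rfl⟩ := N.mkQ_surjective x
          have : t 0 • N.mkQ y = 0 := by
            rw [← map_smul, ← LinearMap.mem_ker, Submodule.ker_mkQ]
            exact ⟨y, rfl⟩
          rw [this]
          exact zero_mem _
        · exact Submodule.smul_mem_smul (Ideal.subset_span ⟨i, rfl⟩) trivial
      | zero => rw [zero_smul]; exact zero_mem _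
      | add a b _ _ ha hb => rw [add_smul]; exact add_mem ha hb
      | smul a b _ hb => rw [smul_assoc]; exact Submodule.smul_mem _ _ hb
    rw [Submodule.Quotient.subsingleton_iff] at hq
    exact subsingleton_of_shiftMap_injective (hP 0).1 (LinearMap.range_eq_top.1 hq)

end Nakayama

/-! ### Adic topologies -/

section Adic

variable {R : Type*} [CommRing R] {I : Ideal R} {M : Type*} [AddCommGroup M] [Module R M]

theorem IsPrecomplete.exists_limit (hM : IsPrecomplete I M) (f : ℕ → M)
    (hf : ∀ n, f (n + 1) - f n ∈ (I ^ n • ⊤ : Submodule R M)) :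
    ∃ L, ∀ n, f n - L ∈ (I ^ n • ⊤ : Submodule R M) := by
  obtain ⟨L, hL⟩ := hM.prec (f := f) (by
    intro m n hmn
    rw [SModEq.sub_mem]
    induction n, hmn using Nat.le_induction with
    | base => rw [sub_self]; exact zero_mem _
    | succ n hmn ih =>
      have := Submodule.sub_mem _ ih
        (Submodule.smul_mono_left (Ideal.pow_le_pow_right hmn) (hf n))
      simpa using this)
  exact ⟨L, fun n => SModEq.sub_mem.1 (hL n)⟩

theorem IsHausdorff.eq_zero (hM : IsHausdorff I M) {x : M}
    (hx : ∀ n, x ∈ (I ^ n • ⊤ : Submodule R M)) : x = 0 :=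
  hM.haus x fun n => SModEq.zero.2 (hx n)

/-- Successive differences lift to `Iⁿ M`, so their partial sums converge upstairs. -/
theorem IsPrecomplete.of_surjective' {N : Type*} [AddCommGroup N] [Module R N]
    (hM : IsPrecomplete I M) (p : M →ₗ[R] N) (hp : Function.Surjective p) :
    IsPrecomplete I N := by
  have key (n : ℕ) : (I ^ n • ⊤ : Submodule R N) = (I ^ n • ⊤ : Submodule R M).map p := by
    rw [Submodule.map_smul'', Submodule.map_top, LinearMap.range_eq_top.2 hp]
  refine ⟨fun f hf => ?_⟩
  have h (n : ℕ) : ∃ c ∈ (I ^ n • ⊤ : Submodule R M), p c = f (n + 1) - f n := by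
    rw [← Submodule.mem_map, ← key]
    exact SModEq.sub_mem.1 (hf n.le_succ).symm
  choose c hc hpc using h
  obtain ⟨c₀, hc₀⟩ := hp (f 0)
  obtain ⟨L, hL⟩ := hM.exists_limit (fun n => c₀ + ∑ i ∈ Finset.range n, c i) fun n => by
    rw [Finset.sum_range_succ]
    simpa using hc n
  refine ⟨p L, fun n => SModEq.sub_mem.2 ?_⟩
  have : f n = p (c₀ + ∑ i ∈ Finset.range n, c i) := by
    rw [map_add, map_sum, hc₀, Finset.sum_congr rfl fun i _ => hpc i, Finset.sum_range_sub]
    simp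
  rw [this, ← map_sub, key]
  exact Submodule.mem_map_of_mem (hL n)

theorem Submodule.exists_sum_of_mem_span_range_smul {m : ℕ} (t : Fin m → R)
    (N : Submodule R M) {x : M} (hx : x ∈ Ideal.span (Set.range t) • N) :
    ∃ c : Fin m → M, (∀ i, c i ∈ N) ∧ x = ∑ i, t i • c i := by
  induction hx using Submodule.smul_induction_on' with
  | smul r hr n hn =>
    obtain ⟨a, rfl⟩ := (Submodule.mem_span_range_iff_exists_fun R).1 hr
    refine ⟨fun i => a i • n, fun i => N.smul_mem _ hn, ?_⟩
    simp only [Finset.sum_smul, smul_smul, smul_eq_mul, mul_comm]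
  | add x _ y _ hx hy =>
    obtain ⟨a, ha, rfl⟩ := hx
    obtain ⟨b, hb, rfl⟩ := hy
    exact ⟨a + b, fun i => N.add_mem (ha i) (hb i), by simp [Finset.sum_add_distrib]⟩

theorem Ideal.FG.exists_fin_span {K : Ideal R} (hK : K.FG) :
    ∃ (m : ℕ) (t : Fin m → R), Ideal.span (Set.range t) = K :=
  Submodule.fg_iff_exists_fin_generating_family.1 hK

end Adic

/-! ### Flatness modulo an ideal -/

section FlatModulo

/-- Every linear relation in `F` modulo the ideal `K` is trivial modulo `K`. -/
def FlatModulo {R : Type*} [CommRing R] (K : Ideal R) (F : Type*) [AddCommGroup F] [Module R F] :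
    Prop :=
  ∀ (l : ℕ) (s : Fin l → R) (x : Fin l → F), ∑ i, s i • x i ∈ (K • ⊤ : Submodule R F) →
    ∃ (k : ℕ) (a : Fin l → Fin k → R) (y : Fin k → F),
      (∀ i, x i - ∑ j, a i j • y j ∈ (K • ⊤ : Submodule R F)) ∧ ∀ j, ∑ i, a i j * s i ∈ K

theorem FlatModulo.flat {R : Type*} [CommRing R] {K : Ideal R} {F : Type*} [AddCommGroup F]
    [Module R F] (h : FlatModulo K F) : Module.Flat (R ⧸ K) (F ⧸ (K • ⊤ : Submodule R F)) := by
  refine Module.Flat.of_forall_isTrivialRelation fun {l f x} hfx => ?_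
  obtain ⟨s, rfl⟩ : ∃ s : Fin l → R, f = fun i => Ideal.Quotient.mk K (s i) :=
    ⟨fun i => (f i).out, funext fun i => (Ideal.Quotient.mk_out _).symm⟩
  obtain ⟨z, rfl⟩ : ∃ z : Fin l → F, x = fun i => Submodule.Quotient.mk (z i) :=
    ⟨fun i => (x i).out, funext fun i => (Quotient.out_eq' (x i)).symm⟩
  obtain ⟨k, a, y, h₁, h₂⟩ := h l s z (by
    rw [← Submodule.ker_mkQ (K • ⊤ : Submodule R F), LinearMap.mem_ker, map_sum]
    exact hfx)
  refine ⟨k, fun i j => Ideal.Quotient.mk K (a i j), fun j => Submodule.Quotient.mk (y j),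
    fun i => ?_, fun j => ?_⟩
  · have := h₁ i
    rw [← Submodule.ker_mkQ (K • ⊤ : Submodule R F), LinearMap.mem_ker, map_sub, map_sum,
      sub_eq_zero] at this
    exact this
  · have := Ideal.Quotient.eq_zero_iff_mem.2 (h₂ j)
    rw [map_sum] at this
    rw [← this]
    refine Finset.sum_congr rfl fun i _ => ?_
    rw [map_mul, mul_comm]

variable {S : Type u} [CommRing S] {J : Ideal S} {F : Type u} [AddCommGroup F] [Module S F]

theorem isTorsionModule_of_pow_le {K : Ideal S} {n : ℕ} (hn : J ^ n ≤ K) {M : Type u}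
    [AddCommGroup M] [Module S M] (hM : ∀ r ∈ K, ∀ x : M, r • x = 0) : IsTorsionModule J M :=
  -- The exponent `n + 1` rather than `n` meets the requirement that it be at least `1`.
  fun s hs x => ⟨n + 1, by omega,
    hM _ (hn (Ideal.pow_le_pow_right n.le_succ (Ideal.pow_mem_pow hs _))) x⟩

/-- `S/K` and its submodule generated by the coefficients are `J`-torsion, so tensoring with `F`
keeps the inclusion injective, and the equational criterion applies to the relation. -/
theorem IsContraflat.flatModulo (hF : IsContraflat J F) {K : Ideal S} {n : ℕ}
    (hn : J ^ n ≤ K) : FlatModulo K F := by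
  intro l s x hsx
  let m : Fin l → S ⧸ K := fun i => Ideal.Quotient.mk K (s i)
  have hK : ∀ r ∈ K, ∀ x : S ⧸ K, r • x = 0 := fun r hr x => by
    rw [Algebra.smul_def, Ideal.Quotient.algebraMap_eq, Ideal.Quotient.eq_zero_iff_mem.2 hr,
      zero_mul]
  let A : Submodule S (S ⧸ K) := Submodule.span S (Set.range m)
  have hA : Function.Injective (A.subtype.rTensor F) :=
    (hF.2 A (S ⧸ K) ((S ⧸ K) ⧸ A) A.subtype A.mkQ
      (isTorsionModule_of_pow_le hn fun r hr x => Subtype.ext (hK r hr x))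
      (isTorsionModule_of_pow_le hn hK)
      (isTorsionModule_of_pow_le hn fun r hr x => by
        obtain ⟨x, rfl⟩ := A.mkQ_surjective x
        rw [← map_smul, hK r hr, map_zero])
      A.injective_subtype (LinearMap.exact_subtype_mkQ A) A.mkQ_surjective).1
  obtain ⟨k, a, y, h₁, h₂⟩ :=
    TensorProduct.vanishesTrivially_of_sum_tmul_eq_zero_of_rTensor_injective S (m := m) (n := x)
      hA (by
        apply (quotTensorEquivQuotSMul F K).injective
        rw [map_sum, map_zero]
        simp only [m, quotTensorEquivQuotSMul_mk_tmul]
        rw [← Submodule.ker_mkQ (K • ⊤ : Submodule S F), LinearMap.mem_ker, map_sum] at hsx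
        exact hsx)
  refine ⟨k, a, y, fun i => by rw [h₁ i, sub_self]; exact zero_mem _, fun j => ?_⟩
  rw [← Ideal.Quotient.eq_zero_iff_mem, map_sum, ← h₂ j]
  refine Finset.sum_congr rfl fun i _ => ?_
  rw [Algebra.smul_def, map_mul]
  rfl

end FlatModulo

/-! ### Contraflat quotseparated contramodules are separated -/

section Separated

variable {S : Type u} [CommRing S] {J : Ideal S}

/-- This is a vanishing of `Tor₁` modulo `K` in elementary terms. Writing `c = ∑ tᵢbᵢ`, the relation
`∑ tᵢ p(bᵢ)` is trivial modulo `K`; lifting its trivialization to `C` changes each `bᵢ` into an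
element of `ker p`, at the cost of an error in `KC`. -/
theorem mem_smul_ker_sup_of_flatModulo {C F : Type*} [AddCommGroup C] [AddCommGroup F]
    [Module S C] [Module S F] (p : C →ₗ[S] F) (hp : Function.Surjective p) {K L : Ideal S}
    (hL : L.FG) (hF : FlatModulo K F) {c : C} (hc : c ∈ (L • ⊤ : Submodule S C))
    (hpc : p c ∈ (K • ⊤ : Submodule S F)) :
    c ∈ L • LinearMap.ker p ⊔ (K • ⊤ : Submodule S C) := by
  obtain ⟨m, t, rfl⟩ := hL.exists_fin_span
  obtain ⟨b, -, rfl⟩ := Submodule.exists_sum_of_mem_span_range_smul t ⊤ hc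
  obtain ⟨k, a, y, h₁, h₂⟩ := hF m t (fun i => p (b i)) (by simpa using hpc)
  choose z hz using fun j => hp (y j)
  have h₃ (i) : ∃ d ∈ (K • ⊤ : Submodule S C), p d = p (b i) - ∑ j, a i j • y j := by
    rw [← Submodule.mem_map, Submodule.map_smul'', Submodule.map_top,
      LinearMap.range_eq_top.2 hp]
    exact h₁ i
  choose d hd hpd using h₃
  have h₄ (i) : b i - ∑ j, a i j • z j - d i ∈ LinearMap.ker p := by
    simp [hpd, hz]
  have h₅ : ∑ i, t i • b i = (∑ i, t i • (b i - ∑ j, a i j • z j - d i)) +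
      (∑ j, (∑ i, a i j * t i) • z j + ∑ i, t i • d i) := by
    have : ∑ j, (∑ i, a i j * t i) • z j = ∑ i, t i • ∑ j, a i j • z j := by
      simp only [Finset.sum_smul, Finset.smul_sum, smul_smul]
      rw [Finset.sum_comm]
      simp only [mul_comm]
    rw [this]
    simp only [smul_sub, Finset.sum_sub_distrib]
    abel
  rw [h₅]
  refine Submodule.add_mem_sup (Submodule.sum_mem _ fun i _ => ?_)
    (Submodule.add_mem _ (Submodule.sum_mem _ fun j _ => ?_) (Submodule.sum_mem _ fun i _ => ?_))
  · exact Submodule.smul_mem_smul (Ideal.subset_span ⟨i, rfl⟩) (h₄ i)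
  · exact Submodule.smul_mem_smul (h₂ j) trivial
  · exact Submodule.smul_mem _ _ (hd i)

/-- A lift of `x` in `JC` is pushed into ever higher `JⁿC` by subtracting elements of `Jⁿ ker p`.
These corrections, with one factor from `J` pulled out, sum to limits `wᵢ` with lift `∑ tᵢwᵢ`. Each
`wᵢ` is a limit of elements of `ker p`, so `p(wᵢ)` lies in `⋂ JⁿF`. -/
theorem iInf_pow_smul_le_smul {C F : Type*} [AddCommGroup C] [AddCommGroup F]
    [Module S C] [Module S F] (hJ : J.FG) (hC : IsAdicComplete J C)
    (p : C →ₗ[S] F) (hp : Function.Surjective p) (hF : ∀ n, FlatModulo (J ^ n) F) :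
    (⨅ n, J ^ n • ⊤ : Submodule S F) ≤ J • (⨅ n, J ^ n • ⊤ : Submodule S F) := by
  set D : Submodule S F := ⨅ n, J ^ n • ⊤ with hD
  have mem_D {x : F} : x ∈ D ↔ ∀ n, x ∈ (J ^ n • ⊤ : Submodule S F) := by
    rw [hD, Submodule.mem_iInf]
  intro x hx
  obtain ⟨y₀, hy₀, rfl⟩ : ∃ c ∈ (J ^ 1 • ⊤ : Submodule S C), p c = x := by
    rw [← Submodule.mem_map, Submodule.map_smul'', Submodule.map_top,
      LinearMap.range_eq_top.2 hp]
    exact mem_D.1 hx 1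
  have step (n : ℕ) (y : C) (hy : y ∈ (J ^ (n + 1) • ⊤ : Submodule S C) ∧ p y ∈ D) :
      ∃ z : C, (z ∈ (J ^ (n + 2) • ⊤ : Submodule S C) ∧ p z ∈ D) ∧
        y - z ∈ J ^ (n + 1) • LinearMap.ker p := by
    obtain ⟨u, hu, z, hz, rfl⟩ := Submodule.mem_sup.1
      (mem_smul_ker_sup_of_flatModulo p hp (hJ.pow (n := n + 1)) (hF (n + 2)) hy.1
        (mem_D.1 hy.2 _))
    have hu0 : p u = 0 := Submodule.smul_le_right hu
    refine ⟨z, ⟨hz, by simpa [hu0] using hy.2⟩, by simpa using hu⟩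
  choose! g hg using step
  let y : ℕ → C := fun n => Nat.rec y₀ g n
  have hy (n : ℕ) : y n ∈ (J ^ (n + 1) • ⊤ : Submodule S C) ∧ p (y n) ∈ D := by
    induction n with
    | zero => exact ⟨hy₀, hx⟩
    | succ n ih => exact (hg n (y n) ih).1
  have hyu (n : ℕ) : y n - y (n + 1) ∈ J ^ (n + 1) • LinearMap.ker p := (hg n (y n) (hy n)).2
  obtain ⟨m, t, ht⟩ := hJ.exists_fin_span
  have hv (n : ℕ) : ∃ v : Fin m → C, (∀ i, v i ∈ J ^ n • LinearMap.ker p) ∧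
      y n - y (n + 1) = ∑ i, t i • v i := by
    apply Submodule.exists_sum_of_mem_span_range_smul
    rw [ht, ← Submodule.mul_smul, ← pow_succ']
    exact hyu n
  choose v hv hyv using hv
  choose w hw using fun i => hC.toIsPrecomplete.exists_limit
    (fun n => ∑ j ∈ Finset.range n, v j i) fun n => by
      rw [Finset.sum_range_succ, add_sub_cancel_left]
      exact Submodule.smul_mono le_rfl le_top (hv n i)
  have hpw (i) : p (w i) ∈ D := by
    refine mem_D.2 fun n => ?_
    have := Submodule.mem_map_of_mem (f := p) (hw i n)
    rw [Submodule.map_smul'', Submodule.map_top, LinearMap.range_eq_top.2 hp, map_sub,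
      map_sum, Finset.sum_eq_zero fun j _ => Submodule.smul_le_right (hv j i), zero_sub,
      neg_mem_iff] at this
    exact this
  have hyw : y₀ - ∑ i, t i • w i = 0 := by
    refine hC.toIsHausdorff.eq_zero fun n => ?_
    have h₁ : y₀ - y n = ∑ i, t i • ∑ j ∈ Finset.range n, v j i := by
      simp only [Finset.smul_sum]
      rw [Finset.sum_comm, ← Finset.sum_congr rfl fun j _ => hyv j, Finset.sum_range_sub']
      rfl
    have h₂ : y₀ - ∑ i, t i • w i =
        y n + ∑ i, t i • (∑ j ∈ Finset.range n, v j i - w i) := by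
      simp only [smul_sub, Finset.sum_sub_distrib]
      rw [← h₁]
      abel
    rw [h₂]
    exact add_mem (Submodule.smul_mono_left (Ideal.pow_le_pow_right n.le_succ) (hy n).1)
      (Submodule.sum_mem _ fun i _ => Submodule.smul_mem _ _ (hw i n))
  rw [sub_eq_zero.1 hyw, map_sum]
  refine Submodule.sum_mem _ fun i _ => ?_
  rw [map_smul]
  exact Submodule.smul_mem_smul (ht ▸ Ideal.subset_span ⟨i, rfl⟩) (hpw i)

/-- The preimage in `F` satisfies `bₙ = aₙ + s bₙ₊₁`; iterating with `s ∈ J` places every `bₙ` in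
all `JᵏF`. -/
theorem shiftMap_bijective_iInf {F : Type*} [AddCommGroup F] [Module S F] {s : S} (hs : s ∈ J)
    (hF : Function.Bijective (shiftMap s F)) :
    Function.Bijective (shiftMap s (⨅ n, J ^ n • ⊤ : Submodule S F)) := by
  set D : Submodule S F := ⨅ n, J ^ n • ⊤ with hD
  have mem_D {x : F} : x ∈ D ↔ ∀ n, x ∈ (J ^ n • ⊤ : Submodule S F) := by
    rw [hD, Submodule.mem_iInf]
  constructor
  · intro a b hab
    have : shiftMap s F (fun n => (a n : F)) = shiftMap s F (fun n => (b n : F)) := by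
      funext n
      exact congrArg Subtype.val (congrFun hab n)
    funext n
    exact Subtype.ext (congrFun (hF.1 this) n)
  · intro a
    obtain ⟨b, hb⟩ := hF.2 fun n => (a n : F)
    have hb' (n : ℕ) : b n = a n + s • b (n + 1) := by
      have := congrFun hb n
      rw [shiftMap_apply, sub_eq_iff_eq_add] at this
      exact this
    have hbD (k : ℕ) : ∀ n, b n ∈ (J ^ k • ⊤ : Submodule S F) := by
      induction k with
      | zero => intro n; simp
      | succ k ih =>
        intro n
        rw [hb' n]
        refine add_mem (mem_D.1 (a n).2 _) ?_
        rw [pow_succ', Submodule.mul_smul]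
        exact Submodule.smul_mem_smul hs (ih _)
    exact ⟨fun n => ⟨b n, mem_D.2 fun k => hbD k n⟩, funext fun n => Subtype.ext (congrFun hb n)⟩

theorem IsQuotseparatedContramodule.isAdicComplete (hJ : J.FG) {F : Type u} [AddCommGroup F]
    [Module S F] (hq : IsQuotseparatedContramodule J F) (hF : IsContraflat J F) :
    IsAdicComplete J F := by
  obtain ⟨hcontra, C, _, _, p, hC, hp⟩ := hq
  have : IsPrecomplete J F := hC.toIsPrecomplete.of_surjective' p hp
  suffices h : (⨅ n, J ^ n • ⊤ : Submodule S F) = ⊥ by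
    refine { haus' := fun x hx => ?_ }
    rw [← Submodule.mem_bot S, ← h, Submodule.mem_iInf]
    exact fun n => SModEq.zero.1 (hx n)
  have hle := iInf_pow_smul_le_smul hJ hC p hp fun n => hF.flatModulo (K := J ^ n) le_rfl
  obtain ⟨m, t, ht⟩ := hJ.exists_fin_span
  rw [← Submodule.subsingleton_iff_eq_bot]
  refine subsingleton_of_span_smul_top_eq_top t (fun i => ?_) ?_
  · have hi : t i ∈ J := ht ▸ Ideal.subset_span ⟨i, rfl⟩
    exact shiftMap_bijective_iInf hi (isContramodule_iff.1 hcontra _ hi)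
  · rw [ht, eq_top_iff]
    rintro ⟨x, hx⟩ -
    have := hle hx
    apply (Submodule.injective_subtype _).mem_set_image.1
    rw [← Submodule.map_coe, Submodule.map_smul'', Submodule.map_top, Submodule.range_subtype]
    exact this

end Separated

/-! ### Systems of linear equations -/

section Systems

theorem Submodule.mem_smul_top_pi_iff {R : Type*} [CommRing R] (L : Ideal R) {ι : Type*}
    [Fintype ι] {M : Type*} [AddCommGroup M] [Module R M] {x : ι → M} :
    x ∈ (L • ⊤ : Submodule R (ι → M)) ↔ ∀ i, x i ∈ (L • ⊤ : Submodule R M) := by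
  classical
  constructor
  · intro hx i
    have := Submodule.mem_map_of_mem (f := LinearMap.proj (R := R) (φ := fun _ => M) i) hx
    rw [Submodule.map_smul''] at this
    exact Submodule.smul_mono le_rfl le_top this
  · intro hx
    rw [← Finset.univ_sum_single x]
    refine Submodule.sum_mem _ fun i _ => ?_
    have := Submodule.mem_map_of_mem (f := LinearMap.single R (fun _ : ι => M) i) (hx i)
    rw [Submodule.map_smul''] at this
    exact Submodule.smul_mono le_rfl le_top this

/-- `F/LF` is flat over `S/L`, hence over `R/K` by transitivity, and the equational criterion for
systems of equations with coefficients in `R/K` is lifted to `R` and `F`. -/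
theorem FlatModulo.exists_factorization {R S : Type*} [CommRing R] [CommRing S] {f : R →+* S}
    {K : Ideal R} {L : Ideal S} {h : K ≤ L.comap f} (hf : (Ideal.quotientMap L f h).Flat)
    {F : Type*} [AddCommGroup F] [Module S F] (hF : FlatModulo L F)
    {α β : Type*} [Fintype α] [Fintype β] (M : β → α → R) (y : α → F)
    (hy : ∀ i, ∑ j, f (M i j) • y j ∈ (L • ⊤ : Submodule S F)) :
    ∃ (k : ℕ) (z : Fin k → α → R) (g : Fin k → F), (∀ c i, ∑ j, M i j * z c j ∈ K) ∧
      ∀ j, y j - ∑ c, f (z c j) • g c ∈ (L • ⊤ : Submodule S F) := by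
  classical
  let X := F ⧸ (L • ⊤ : Submodule S F)
  let φ := Ideal.quotientMap L f h
  have := hF.flat
  let _ : Algebra (R ⧸ K) (S ⧸ L) := φ.toAlgebra
  let _ : Module (R ⧸ K) X := Module.compHom X φ
  have : IsScalarTower (R ⧸ K) (S ⧸ L) X := ⟨fun a b x => mul_smul (φ a) b x⟩
  have : Module.Flat (R ⧸ K) (S ⧸ L) := hf
  have : Module.Flat (R ⧸ K) X := Module.Flat.trans _ (S ⧸ L) _
  have smul_mk (r : R) (v : F) :
      Ideal.Quotient.mk K r • (Submodule.Quotient.mk v : X) = Submodule.Quotient.mk (f r • v) := rfl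
  let T : (β → R ⧸ K) →ₗ[R ⧸ K] (α → R ⧸ K) :=
    Fintype.linearCombination (R ⧸ K) fun i j => Ideal.Quotient.mk K (M i j)
  let x : (α → R ⧸ K) →ₗ[R ⧸ K] X :=
    Fintype.linearCombination (R ⧸ K) fun j => Submodule.Quotient.mk (y j)
  have hxT : x ∘ₗ T = 0 := by
    ext i
    have hT : T (Pi.single i 1) = fun j => Ideal.Quotient.mk K (M i j) := by
      simp [T, Fintype.linearCombination_apply_single]
    simp only [LinearMap.comp_apply, LinearMap.single_apply, hT, LinearMap.zero_apply, x,
      Fintype.linearCombination_apply, smul_mk]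
    have := hy i
    rw [← Submodule.ker_mkQ (L • ⊤ : Submodule S F), LinearMap.mem_ker, map_sum] at this
    exact this
  obtain ⟨k, a, y', hxa, haT⟩ := Module.Flat.exists_factorization_of_comp_eq_zero_of_free hxT
  obtain ⟨z, hz⟩ : ∃ z : Fin k → α → R, ∀ c j,
      Ideal.Quotient.mk K (z c j) = a (Pi.single j 1) c :=
    ⟨fun c j => (a (Pi.single j 1) c).out, fun c j => Ideal.Quotient.mk_out _⟩
  obtain ⟨g, hg⟩ : ∃ g : Fin k → F, ∀ c, (Submodule.Quotient.mk (g c) : X) =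
      y' (Finsupp.single c 1) :=
    ⟨fun c => (y' (Finsupp.single c 1)).out, fun c => Quotient.out_eq' _⟩
  refine ⟨k, z, g, fun c i => ?_, fun j => ?_⟩
  · rw [← Ideal.Quotient.eq_zero_iff_mem, map_sum]
    have := DFunLike.congr_fun (LinearMap.congr_fun haT (Pi.single i 1)) c
    simp only [LinearMap.comp_apply, T, Fintype.linearCombination_apply_single, one_smul,
      LinearMap.zero_apply, Finsupp.coe_zero, Pi.zero_apply] at this
    rw [← this, pi_eq_sum_univ' (fun j => Ideal.Quotient.mk K (M i j)), map_sum,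
      Finsupp.finsetSum_apply]
    refine Finset.sum_congr rfl fun j _ => ?_
    simp only [map_smul, Finsupp.smul_apply, map_mul, hz, smul_eq_mul]
  · have h1 : (Submodule.Quotient.mk (y j) : X) = x (Pi.single j 1) := by
      simp [x, Fintype.linearCombination_apply_single]
    have h2 : a (Pi.single j 1) = ∑ c, a (Pi.single j 1) c • Finsupp.single c 1 := by
      simp [Finsupp.univ_sum_single]
    rw [hxa, LinearMap.comp_apply, h2, map_sum] at h1
    rw [← Submodule.ker_mkQ (L • ⊤ : Submodule S F), LinearMap.mem_ker, map_sub, sub_eq_zero,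
      map_sum]
    refine h1.trans (Finset.sum_congr rfl fun c _ => ?_)
    rw [map_smul, ← hg, ← hz]
    rfl

end Systems

/-! ### Closedness of images of maps between complete modules -/

section Closed

/-- Mittag-Leffler: differences of successive approximate preimages are close to `ker T`, so
correcting by kernel elements makes the sequence converge without changing its images. -/
theorem LinearMap.mem_range_of_forall_sub_mem {S : Type*} [CommRing S] {J : Ideal S}
    {A B : Type*} [AddCommGroup A] [AddCommGroup B] [Module S A] [Module S B]
    (hA : IsPrecomplete J A) (hB : IsHausdorff J B) (T : A →ₗ[S] B)
    (hT : ∀ k, ∃ q, ∀ y, T y ∈ (J ^ q • ⊤ : Submodule S B) →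
      ∃ z, T z = 0 ∧ y - z ∈ (J ^ k • ⊤ : Submodule S A))
    {x : B} (hx : ∀ k, ∃ y, x - T y ∈ (J ^ k • ⊤ : Submodule S B)) : ∃ y, T y = x := by
  choose q hq using hT
  -- A monotone precision that dominates both `k` and `q k`.
  let Q (k : ℕ) : ℕ := k + ∑ i ∈ Finset.range (k + 1), q i
  have hQ (k) : Q k ≤ Q (k + 1) :=
    add_le_add k.le_succ (Finset.sum_le_sum_of_subset (by simp))
  have hqQ (k) : q k ≤ Q k :=
    (Finset.single_le_sum (fun _ _ => Nat.zero_le _) (Finset.self_mem_range_succ k)).trans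
      (Nat.le_add_left _ _)
  choose y hy using fun k => hx (Q k)
  have hz (k : ℕ) : ∃ z, T z = 0 ∧ y (k + 1) - y k - z ∈ (J ^ k • ⊤ : Submodule S A) := by
    apply hq
    refine Submodule.smul_mono_left (Ideal.pow_le_pow_right (hqQ k)) ?_
    have := sub_mem (hy k)
      (Submodule.smul_mono_left (Ideal.pow_le_pow_right (hQ k)) (hy (k + 1)))
    rw [map_sub]
    convert this using 1
    abel
  choose z hz0 hz using hz
  obtain ⟨L, hL⟩ := hA.exists_limit (fun k => y k - ∑ i ∈ Finset.range k, z i) fun k => by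
    convert hz k using 1
    rw [Finset.sum_range_succ]
    abel
  refine ⟨L, (sub_eq_zero.1 (hB.eq_zero (x := x - T L) fun k => ?_)).symm⟩
  have h1 : x - T L = (x - T (y k)) + T (y k - ∑ i ∈ Finset.range k, z i - L) := by
    simp only [map_sub, map_sum, hz0, Finset.sum_const_zero]
    abel
  rw [h1]
  refine add_mem (Submodule.smul_mono_left (Ideal.pow_le_pow_right (Nat.le_add_right _ _)) (hy k))
    ?_
  have := Submodule.mem_map_of_mem (f := T) (hL k)
  rw [Submodule.map_smul''] at this
  exact Submodule.smul_mono le_rfl le_top this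

theorem IsPrecomplete.pi_const {S : Type*} [CommRing S] {J : Ideal S} {F : Type*} [AddCommGroup F]
    [Module S F] (hF : IsPrecomplete J F) (ι : Type*) [Fintype ι] : IsPrecomplete J (ι → F) := by
  refine ⟨fun f hf => ?_⟩
  have h (i : ι) := hF.prec (f := fun n => f n i) fun {m n} hmn =>
    SModEq.sub_mem.2 ((Submodule.mem_smul_top_pi_iff _).1 (SModEq.sub_mem.1 (hf hmn)) i)
  choose L hL using h
  exact ⟨L, fun n => SModEq.sub_mem.2 ((Submodule.mem_smul_top_pi_iff _).2 fun i =>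
    SModEq.sub_mem.1 (hL i n))⟩

theorem IsHausdorff.pi_const {S : Type*} [CommRing S] {J : Ideal S} {F : Type*} [AddCommGroup F]
    [Module S F] (hF : IsHausdorff J F) (ι : Type*) [Fintype ι] : IsHausdorff J (ι → F) :=
  ⟨fun _ hx => _root_.funext fun i => hF.eq_zero fun n =>
    (Submodule.mem_smul_top_pi_iff _).1 (SModEq.zero.1 (hx n)) i⟩

end Closed

/-! ### Flatness modulo ideals of the source of a quotflat morphism -/

section Quotflat

/-- The linear map `F ^ α → F ^ β` defined by a matrix with entries in `R`, for a module `F` over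
a ring `S` receiving `R`. -/
def matrixMap {R S : Type*} [CommRing R] [CommRing S] (f : R →+* S) {α β : Type*} [Fintype α]
    (M : β → α → R) (F : Type*) [AddCommGroup F] [Module S F] : (α → F) →ₗ[S] (β → F) :=
  LinearMap.pi fun i => ∑ j, f (M i j) • LinearMap.proj j

@[simp]
theorem matrixMap_apply {R S : Type*} [CommRing R] [CommRing S] (f : R →+* S) {α β : Type*}
    [Fintype α] (M : β → α → R) {F : Type*} [AddCommGroup F] [Module S F] (y : α → F) (i : β) :
    matrixMap f M F y i = ∑ j, f (M i j) • y j := by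
  simp [matrixMap]

/-- All vectors over `L` lie in the image of `M`; multiplying that inclusion by `K` puts the
preimages in `K`. -/
theorem exists_mulVec_eq_of_mem_mul {R : Type*} [CommRing R] {α β : Type*} [Fintype α] [Fintype β]
    (M : β → α → R) {K L : Ideal R}
    (hM : ∀ v : β → R, (∀ i, v i ∈ L) → ∃ w : α → R, ∀ i, ∑ j, M i j * w j = v i)
    (v : β → R) (hv : ∀ i, v i ∈ K * L) :
    ∃ w : α → R, (∀ j, w j ∈ K) ∧ ∀ i, ∑ j, M i j * w j = v i := by
  let T := matrixMap (RingHom.id R) M R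
  have hT (w i) : T w i = ∑ j, M i j * w j := by simp [T]
  have h1 : (L • ⊤ : Submodule R (β → R)) ≤ LinearMap.range T := by
    intro v hv
    obtain ⟨w, hw⟩ := hM v fun i => by
      simpa using (Submodule.mem_smul_top_pi_iff _).1 hv i
    exact ⟨w, funext fun i => by rw [hT, hw]⟩
  have h2 : v ∈ (K • ⊤ : Submodule R (α → R)).map T := by
    rw [Submodule.map_smul'', Submodule.map_top]
    refine Submodule.smul_mono le_rfl h1 ?_
    rw [← Submodule.mul_smul, Submodule.mem_smul_top_pi_iff]
    simpa using hv
  obtain ⟨w, hw, rfl⟩ := h2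
  exact ⟨w, fun j => by simpa using (Submodule.mem_smul_top_pi_iff _).1 hw j,
    fun i => (hT w i).symm⟩

variable {R S : Type u} [CommRing R] [CommRing S] {f : R →+* S} {I : Ideal R} {J : Ideal S}

theorem IsQuotflat.mem_range_matrixMap (hf : IsQuotflat f I J) (hIJ : I.map f ≤ J)
    {F : Type u} [AddCommGroup F] [Module S F] (hF : IsAdicComplete J F) (hc : IsContraflat J F)
    {α β : Type} [Fintype α] [Fintype β] (M : β → α → R) {L : Ideal R} {n : ℕ} (hn : I ^ n ≤ L)
    (hM : ∀ v : β → R, (∀ i, v i ∈ L) → ∃ w : α → R, ∀ i, ∑ j, M i j * w j = v i)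
    {x : β → F} (hx : ∀ k, ∃ y, x - matrixMap f M F y ∈ (J ^ k • ⊤ : Submodule S (β → F))) :
    ∃ y, matrixMap f M F y = x := by
  obtain ⟨I', J', -, -, hle, hge, hflat⟩ := hf
  refine LinearMap.mem_range_of_forall_sub_mem (hF.toIsPrecomplete.pi_const α)
    (hF.toIsHausdorff.pi_const β) _ (fun k => ?_) hx
  -- At this level `I'` lies in `Iᵏ · Iⁿ ⊆ Iᵏ L`, and the index is at least `1`.
  obtain ⟨q, -, -, hq⟩ := hge (k + n + 1) (by omega)
  obtain ⟨h, hfl⟩ := hflat (k + n + 1) (by omega)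
  obtain ⟨hI, hJ⟩ := hle (k + n + 1) (by omega)
  have hIk : I' (k + n + 1) ≤ I ^ k * L := hI.trans <| (Ideal.pow_le_pow_right (by omega)).trans <|
    (pow_add I k n).le.trans (Ideal.mul_mono_right hn)
  have hJk : J' (k + n + 1) ≤ J ^ k := hJ.trans (Ideal.pow_le_pow_right (by omega))
  have hfI : ∀ r ∈ I ^ k, f r ∈ J ^ k := fun r hr =>
    Ideal.pow_right_mono hIJ k (Ideal.map_pow f I k ▸ Ideal.mem_map_of_mem f hr)
  refine ⟨q, fun y hy => ?_⟩
  obtain ⟨m, z, g, hz, hyz⟩ := FlatModulo.exists_factorization hfl (hc.flatModulo hq) M y fun i => by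
    have := (Submodule.mem_smul_top_pi_iff _).1 hy i
    rw [matrixMap_apply] at this
    exact Submodule.smul_mono_left hq this
  choose w hw hMw using fun c => exists_mulVec_eq_of_mem_mul M hM (fun i => ∑ j, M i j * z c j)
    fun i => hIk (hz c i)
  -- Each `z c` solves the system only modulo `IᵏL`; subtracting `w c`, with entries in `Iᵏ`, makes
  -- it an exact solution and moves the combination by an element of `JᵏF`.
  refine ⟨fun j => ∑ c, f (z c j - w c j) • g c, ?_, ?_⟩
  · funext i
    rw [matrixMap_apply, Pi.zero_apply]
    simp only [Finset.smul_sum, smul_smul, ← map_mul]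
    rw [Finset.sum_comm]
    refine Finset.sum_eq_zero fun c _ => ?_
    rw [← Finset.sum_smul, ← map_sum]
    simp only [mul_sub, Finset.sum_sub_distrib, hMw, sub_self, map_zero, zero_smul]
  · rw [Submodule.mem_smul_top_pi_iff]
    intro j
    have h1 : (y - fun j => ∑ c, f (z c j - w c j) • g c) j =
        (y j - ∑ c, f (z c j) • g c) + ∑ c, f (w c j) • g c := by
      simp only [Pi.sub_apply, map_sub, sub_smul, Finset.sum_sub_distrib]
      abel
    rw [h1]
    exact add_mem (Submodule.smul_mono_left hJk (hyz j)) (Submodule.sum_mem _ fun c _ =>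
      Submodule.smul_mem_smul (hfI _ (hw c j)) trivial)

/-- In an adically coherent ring, linear equations modulo an open finitely generated ideal have
finitely generated modules of solutions. -/
theorem IsAdicallyCoherent.exists_matrix (hR : IsAdicallyCoherent I) (hI : I.FG) {L : Ideal R}
    (hL : L.FG) {q : ℕ} (hq : I ^ q ≤ L) {l : ℕ} (r : Fin l → R) :
    ∃ (a : ℕ) (M : Fin l → Fin a → R), ∀ v : Fin l → R, ∑ i, v i * r i ∈ L ↔
      ∃ w : Fin a → R, ∀ i, ∑ j, M i j * w j = v i := by
  obtain ⟨c, g, rfl⟩ := hL.exists_fin_span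
  -- The relations between `r` and the generators `g` of `L` modulo `I ^ (q + 1)` are finitely
  -- generated by coherence; the `r`-components of these relations are exactly the required vectors.
  let A := R ⧸ I ^ (q + 1)
  have hq' : I ^ (q + 1) ≤ I ^ q := Ideal.pow_le_pow_right q.le_succ
  let h : Fin l ⊕ Fin c → A := fun i => Ideal.Quotient.mk _ (Sum.elim r g i)
  let K : Ideal A := Ideal.span (Set.range h)
  have hA : Module.FinitePresentation R A :=
    Module.finitePresentation_of_surjective (Submodule.mkQ (I ^ (q + 1)))
      (Submodule.mkQ_surjective _) (by rw [Submodule.ker_mkQ]; exact hI.pow)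
  have hK : Module.FinitePresentation A K :=
    hR (q + 1) (by omega) K (Submodule.fg_span (Set.finite_range h))
  have hK' : Module.FinitePresentation R K := Module.FinitePresentation.trans R K A
  let p : (Fin l ⊕ Fin c → R) →ₗ[R] K :=
    Fintype.linearCombination R fun i => ⟨h i, Ideal.subset_span ⟨i, rfl⟩⟩
  have hp0 (v) : (p v : A) = Ideal.Quotient.mk _ (∑ i, v i * Sum.elim r g i) := by
    rw [map_sum]
    simp only [p, Fintype.linearCombination_apply, Submodule.coe_sum, map_mul]
    rfl
  have hp : Function.Surjective p := by
    rintro ⟨x, hx⟩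
    obtain ⟨b, rfl⟩ := (Submodule.mem_span_range_iff_exists_fun A).1 hx
    refine ⟨fun i => (b i).out, Subtype.ext ?_⟩
    rw [hp0, map_sum]
    refine Finset.sum_congr rfl fun i _ => ?_
    rw [map_mul, Ideal.Quotient.mk_out]
    rfl
  have hker := (Module.FinitePresentation.fg_ker p hp).map (LinearMap.funLeft R R Sum.inl)
  obtain ⟨a, m, hm⟩ := Submodule.fg_iff_exists_fin_generating_family.1 hker
  refine ⟨a, fun i j => m j i, fun v => ?_⟩
  have h1 : (∃ w : Fin a → R, ∀ i, ∑ j, m j i * w j = v i) ↔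
      v ∈ (LinearMap.ker p).map (LinearMap.funLeft R R (Sum.inl : Fin l → Fin l ⊕ Fin c)) := by
    rw [← hm, Submodule.mem_span_range_iff_exists_fun]
    refine exists_congr fun w => ?_
    rw [funext_iff]
    refine forall_congr' fun i => ?_
    simp [mul_comm]
  rw [h1, Submodule.mem_map]
  have mem_ker {z} : z ∈ LinearMap.ker p ↔ ∑ i, z i * Sum.elim r g i ∈ I ^ (q + 1) := by
    rw [← Ideal.Quotient.eq_zero_iff_mem, ← hp0, LinearMap.mem_ker]
    exact Subtype.ext_iff
  constructor
  · intro hv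
    obtain ⟨b, hb⟩ := (Submodule.mem_span_range_iff_exists_fun R).1 hv
    refine ⟨Sum.elim v (-b), mem_ker.2 ?_, by funext i; simp [LinearMap.funLeft]⟩
    simp only [Fintype.sum_sum_type, Sum.elim_inl, Sum.elim_inr, Pi.neg_apply, neg_mul,
      Finset.sum_neg_distrib]
    simp only [smul_eq_mul] at hb
    rw [hb, add_neg_cancel]
    exact zero_mem _
  · rintro ⟨z, hz, rfl⟩
    have := hq (hq' (mem_ker.1 hz))
    rw [Fintype.sum_sum_type] at this
    refine (Submodule.add_mem_iff_left _ ?_).1 this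
    exact Submodule.sum_mem _ fun j _ => Ideal.mul_mem_left _ _ (Ideal.subset_span ⟨j, rfl⟩)

theorem IsQuotflat.flatModulo [Algebra R S] (hf : IsQuotflat (algebraMap R S) I J)
    (hIJ : I.map (algebraMap R S) ≤ J) (hR : IsAdicallyCoherent I) (hI : I.FG)
    {F : Type u} [AddCommGroup F] [Module S F] [Module R F] [IsScalarTower R S F]
    (hF : IsAdicComplete J F) (hc : IsContraflat J F) {L : Ideal R} (hL : L.FG) {n : ℕ}
    (hn : I ^ n ≤ L) : FlatModulo L F := by
  intro l r x hrx
  obtain ⟨a, M, hM⟩ := hR.exists_matrix hI hL hn r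
  obtain ⟨c, g, rfl⟩ := hL.exists_fin_span
  obtain ⟨x', -, hx'⟩ := Submodule.exists_sum_of_mem_span_range_smul g ⊤ hrx
  obtain ⟨y, hy⟩ : ∃ y, matrixMap (algebraMap R S) M F y = x := by
    refine hf.mem_range_matrixMap hIJ hF hc M hn (fun v hv => (hM v).1 <|
      Submodule.sum_mem _ fun i _ => Ideal.mul_mem_right _ _ (hv i)) fun k => ?_
    obtain ⟨I', J', -, -, hle, hge, hflat⟩ := hf
    obtain ⟨h, hfl⟩ := hflat (k + n + 1) (by omega)
    obtain ⟨q, -, -, hq⟩ := hge (k + n + 1) (by omega)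
    -- The membership becomes one equation `∑ rᵢxᵢ - ∑ gⱼx'ⱼ = 0` in the unknowns `(x, x')`. The
    -- `r`-parts of its approximate solutions satisfy the relation modulo `L`, so they lie in the
    -- image of `M`.
    obtain ⟨m, z, b, hz, hyz⟩ := FlatModulo.exists_factorization hfl (hc.flatModulo hq)
      (fun (_ : Unit) => Sum.elim r (-g)) (Sum.elim x x') fun _ => by
        simp only [Fintype.sum_sum_type, Sum.elim_inl, Sum.elim_inr, Pi.neg_apply,
          algebraMap_smul]
        rw [hx']
        simp
    have hz' (e : Fin m) : ∃ w : Fin a → R, ∀ i, ∑ j, M i j * w j = z e (Sum.inl i) := by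
      rw [← hM]
      have := ((hle (k + n + 1) (by omega)).1.trans
        (Ideal.pow_le_pow_right (by omega : n ≤ k + n + 1))).trans hn (hz e ())
      simp only [Fintype.sum_sum_type, Sum.elim_inl, Sum.elim_inr] at this
      simp only [mul_comm (z e _)]
      refine (Submodule.add_mem_iff_left _ ?_).1 this
      exact Submodule.sum_mem _ fun j _ => Ideal.mul_mem_right _ _
        (neg_mem (Ideal.subset_span ⟨j, rfl⟩))
    choose w hw using hz'
    refine ⟨fun j => ∑ e, algebraMap R S (w e j) • b e, ?_⟩
    rw [Submodule.mem_smul_top_pi_iff]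
    intro i
    have h1 : matrixMap (algebraMap R S) M F (fun j => ∑ e, algebraMap R S (w e j) • b e) i =
        ∑ e, algebraMap R S (z e (Sum.inl i)) • b e := by
      rw [matrixMap_apply]
      simp only [Finset.smul_sum, smul_smul, ← map_mul]
      rw [Finset.sum_comm]
      refine Finset.sum_congr rfl fun e _ => ?_
      rw [← Finset.sum_smul, ← map_sum, hw]
    rw [Pi.sub_apply, h1]
    exact Submodule.smul_mono_left (((hle (k + n + 1) (by omega)).2).trans
      (Ideal.pow_le_pow_right (by omega))) (hyz (Sum.inl i))
  refine ⟨a, M, y, fun i => ?_, fun j => ?_⟩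
  · rw [← hy, matrixMap_apply]
    simp
  · exact (hM fun i => M i j).2 ⟨Pi.single j 1, fun i => by simp [Pi.single_apply]⟩

end Quotflat

/-! ### Finitely generated torsion modules -/

section FiniteTorsion

variable {R : Type u} [CommRing R] {I : Ideal R}

/-- Each element of `I` has a power killing the finitely many generators, so `I` lies in the radical
of the annihilator. -/
theorem IsTorsionModule.exists_pow_le_annihilator (hI : I.FG) {M : Type u} [AddCommGroup M]
    [Module R M] (hM : IsTorsionModule I M) {N : Submodule R M} (hN : N.FG) :
    ∃ n, I ^ n ≤ N.annihilator := by
  refine Ideal.exists_pow_le_of_le_radical_of_fg (fun s hs => ?_) hI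
  obtain ⟨t, rfl⟩ := hN
  choose n _ h using hM s hs
  refine ⟨∑ x ∈ t, n x, ?_⟩
  rw [Submodule.mem_annihilator_span]
  rintro ⟨x, hx⟩
  rw [← Nat.sub_add_cancel (Finset.single_le_sum (fun _ _ => Nat.zero_le _) hx : n x ≤ _), pow_add,
    mul_smul, h, smul_zero]

theorem IsTorsionModule.of_injective {M N : Type u} [AddCommGroup M] [Module R M] [AddCommGroup N]
    [Module R N] (hN : IsTorsionModule I N) (f : M →ₗ[R] N) (hf : Function.Injective f) :
    IsTorsionModule I M := fun s hs x => by
  obtain ⟨n, hn, h⟩ := hN s hs (f x)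
  exact ⟨n, hn, hf (by rw [map_smul, h, map_zero])⟩

theorem IsTorsionModule.of_surjective {M N : Type u} [AddCommGroup M] [Module R M] [AddCommGroup N]
    [Module R N] (hM : IsTorsionModule I M) (f : M →ₗ[R] N) (hf : Function.Surjective f) :
    IsTorsionModule I N := fun s hs y => by
  obtain ⟨x, rfl⟩ := hf y
  obtain ⟨n, hn, h⟩ := hM s hs x
  exact ⟨n, hn, by rw [← map_smul, h, map_zero]⟩

end FiniteTorsion

/-! ### Contraflatness from flatness modulo powers of the ideal -/

section Contraflat

variable {R : Type u} [CommRing R] {I : Ideal R}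

/-- The tensor already vanishes over a finitely generated submodule killed by some `Iⁿ`, where
flatness of `F/IⁿF` trivializes it modulo `Iⁿ`. -/
theorem vanishesTrivially_of_flatModulo (hI : I.FG) {F : Type u} [AddCommGroup F] [Module R F]
    (hF : ∀ n, FlatModulo (I ^ n) F) {B : Type u} [AddCommGroup B] [Module R B]
    (hB : IsTorsionModule I B) {l : ℕ} {b : Fin l → B} {x : Fin l → F}
    (h : ∑ i, b i ⊗ₜ[R] x i = 0) : TensorProduct.VanishesTrivially R b x := by
  let P := Submodule.span R (Set.range b)
  have hbP (i) : b i ∈ P := Submodule.subset_span ⟨i, rfl⟩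
  obtain ⟨Q, hPQ, hQ, hQ0⟩ := TensorProduct.eq_zero_of_fg_of_subtype_eq_zero
    (P := P) (Submodule.fg_span (Set.finite_range b))
    (t := ∑ i, (⟨b i, hbP i⟩ : P) ⊗ₜ[R] x i) (by simpa using h)
  obtain ⟨n, hn⟩ := hB.exists_pow_le_annihilator hI hQ
  obtain ⟨c, g, hg⟩ := (hI.pow (n := n)).exists_fin_span
  let A := R ⧸ I ^ n
  let X := F ⧸ (I ^ n • ⊤ : Submodule R F)
  have htors : Module.IsTorsionBySet R Q (I ^ n : Ideal R) := fun q r =>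
    Subtype.ext (Submodule.mem_annihilator.1 (hn r.2) _ q.2)
  let _ : Module A Q := htors.module
  have := (hF n).flat
  have hst : IsScalarTower R A Q := htors.isScalarTower
  let φ : Q ⊗[R] F →ₗ[R] Q ⊗[A] X := TensorProduct.lift
    (LinearMap.mk₂ R (fun q v => q ⊗ₜ[A] (Submodule.Quotient.mk v : X))
      (fun _ _ _ => TensorProduct.add_tmul _ _ _) (fun _ _ _ => rfl)
      (fun q v w => TensorProduct.tmul_add q (Submodule.Quotient.mk v : X) (Submodule.Quotient.mk w))
      (fun r q v => by
        rw [TensorProduct.smul_tmul']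
        exact TensorProduct.tmul_smul (Ideal.Quotient.mk (I ^ n) r : A) q (Submodule.Quotient.mk v : X)))
  have hφ : ∑ i, (⟨b i, hPQ (hbP i)⟩ : Q) ⊗ₜ[A] (Submodule.Quotient.mk (x i) : X) = 0 := by
    have := congrArg φ hQ0
    rw [map_sum, map_sum, map_zero] at this
    exact this
  obtain ⟨k, a, y, h₁, h₂⟩ :=
    TensorProduct.vanishesTrivially_of_sum_tmul_eq_zero_of_rTensor_injective A
      (Module.Flat.rTensor_preserves_injective_linearMap _ (Submodule.injective_subtype _)) hφ
  obtain ⟨a, rfl⟩ : ∃ a' : Fin l → Fin k → R, a = fun i j => Ideal.Quotient.mk _ (a' i j) :=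
    ⟨fun i j => (a i j).out, funext fun i => funext fun j => (Ideal.Quotient.mk_out _).symm⟩
  obtain ⟨y, rfl⟩ : ∃ y' : Fin k → F, y = fun j => (Submodule.Quotient.mk (y' j) : X) :=
    ⟨fun j => (y j).out, funext fun j => (Quotient.out_eq' (y j)).symm⟩
  have h₃ (i) : x i - ∑ j, a i j • y j ∈ (I ^ n • ⊤ : Submodule R F) := by
    rw [← Submodule.ker_mkQ (I ^ n • ⊤ : Submodule R F), LinearMap.mem_ker, map_sub, map_sum,
      sub_eq_zero]
    exact h₁ i
  have h₄ (i) := Submodule.exists_sum_of_mem_span_range_smul g ⊤ (by rw [hg]; exact h₃ i)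
  choose e _ he using h₄
  -- The extra indices absorb the errors in `IⁿF`: their coefficients `g` lie in `Iⁿ` and kill every
  -- `b i`.
  refine TensorProduct.VanishesTrivially.of_fintype (κ := Fin k ⊕ (Fin l × Fin c))
    (fun i => Sum.elim (a i) fun p => if p.1 = i then g p.2 else 0)
    (Sum.elim y fun p => e p.1 p.2) (fun i => ?_) ?_
  · simp only [Fintype.sum_sum_type, Sum.elim_inl, Sum.elim_inr, Fintype.sum_prod_type, ite_smul,
      zero_smul]
    rw [Finset.sum_comm]
    simp only [Finset.sum_ite_eq', Finset.mem_univ, if_true]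
    rw [← he i]
    abel
  · rintro (j | ⟨i, h⟩)
    · have := congrArg Subtype.val (h₂ j)
      simpa [A, Submodule.coe_sum] using this
    · simp only [Sum.elim_inr, ite_smul, zero_smul, Finset.sum_ite_eq, Finset.mem_univ, if_true]
      exact Submodule.mem_annihilator.1 (hn (hg ▸ Ideal.subset_span ⟨h, rfl⟩)) _ (hPQ (hbP i))

theorem isContraflat_of_flatModulo (hI : I.FG) {F : Type u} [AddCommGroup F] [Module R F]
    (hc : IsContramodule I F) (hF : ∀ n, FlatModulo (I ^ n) F) : IsContraflat I F := by
  refine ⟨hc, fun A B C _ _ _ _ _ _ f g hA hB hC hf hfg hg => ⟨?_, rTensor_exact F hfg hg,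
    LinearMap.rTensor_surjective F hg⟩⟩
  have h := (TensorProduct.forall_vanishesTrivially_iff_forall_rTensor_injective R (M := B)
    (N := F)).1 (fun h => vanishesTrivially_of_flatModulo hI hF hB h) (LinearMap.range f)
  let e := LinearEquiv.ofInjective f hf
  have hfe : f = (LinearMap.range f).subtype ∘ₗ e.toLinearMap := rfl
  rw [hfe, LinearMap.rTensor_comp]
  exact h.comp (LinearEquiv.rTensor F e).injective

theorem IsContraflat.restrictScalars {S : Type u} [CommRing S] [Algebra R S] {J : Ideal S}
    (hI : I.FG) (hJ : J.FG) (hIJ : I.map (algebraMap R S) ≤ J)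
    (hf : IsQuotflat (algebraMap R S) I J) (hR : IsAdicallyCoherent I)
    {F : Type u} [AddCommGroup F] [Module S F] [Module R F] [IsScalarTower R S F]
    (hq : IsQuotseparatedContramodule J F) (hF : IsContraflat J F) : IsContraflat I F := by
  refine isContraflat_of_flatModulo hI ?_ fun n => ?_
  · rw [isContramodule_iff]
    intro r hr
    have h := isContramodule_iff.1 hF.1 _ (hIJ (Ideal.mem_map_of_mem _ hr))
    have : ⇑(shiftMap r F) = shiftMap (algebraMap R S r) F := by
      funext b n
      simp
    rwa [this]
  · exact hf.flatModulo hIJ hR hI (hq.isAdicComplete hJ hF) hF hI.pow le_rfl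

end Contraflat

/-! ### The category of torsion modules -/

namespace TorsionModuleCat

open Limits

variable {R : Type u} [CommRing R] {I : Ideal R}

/-- A torsion module as an object of the category of torsion modules. -/
abbrev of (M : Type u) [AddCommGroup M] [Module R M] (hM : IsTorsionModule I M) :
    TorsionModuleCat I :=
  ⟨ModuleCat.of R M, hM⟩

theorem shortExact_of_exact {A B C : Type u} [AddCommGroup A] [AddCommGroup B] [AddCommGroup C]
    [Module R A] [Module R B] [Module R C] {hA : IsTorsionModule I A} {hB : IsTorsionModule I B}
    {hC : IsTorsionModule I C} (f : A →ₗ[R] B) (g : B →ₗ[R] C) (hf : Function.Injective f)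
    (hfg : Function.Exact f g) (hg : Function.Surjective g) :
    ∃ w, (ShortComplex.mk (X₁ := of A hA) (X₂ := of B hB) (X₃ := of C hC)
      (ObjectProperty.homMk (ModuleCat.ofHom f)) (ObjectProperty.homMk (ModuleCat.ofHom g))
        w).ShortExact := by
  have w : ModuleCat.ofHom f ≫ ModuleCat.ofHom g = 0 :=
    ModuleCat.hom_ext (LinearMap.ext hfg.apply_apply_eq_zero)
  let X := ShortComplex.mk _ _ w
  have hX : X.Exact := (ShortComplex.ShortExact.moduleCat_exact_iff_function_exact X).2 hfg
  have hXf : Mono X.f := (ModuleCat.mono_iff_injective _).2 hf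
  have hXg : Epi X.g := (ModuleCat.epi_iff_surjective _).2 hg
  let Y : ShortComplex (TorsionModuleCat I) :=
    ShortComplex.mk (X₁ := of A hA) (X₂ := of B hB) (X₃ := of C hC)
      (ObjectProperty.homMk (ModuleCat.ofHom f)) (ObjectProperty.homMk (ModuleCat.ofHom g))
      (ObjectProperty.hom_ext _ w)
  have hYf : Mono Y.f := (torsionProperty I).ι.mono_of_mono_map hXf
  have hYg : Epi Y.g := (torsionProperty I).ι.epi_of_epi_map hXg
  exact ⟨Y.zero,
    { exact := Y.exact_of_f_is_kernel <| KernelFork.IsLimit.ofι' _ _ fun k hk =>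
        ⟨ObjectProperty.homMk (hX.lift k.hom (congrArg InducedCategory.Hom.hom hk)),
          ObjectProperty.hom_ext _ (hX.lift_f _ _)⟩ }⟩

/-! ### Quotients as filtered colimits of quotients by finitely generated submodules -/

section FilteredQuotients

variable {N : Type u} [AddCommGroup N] [Module R N] (hN : IsTorsionModule I N)
  (U : Submodule R N)

/-- The poset of finitely generated submodules of `U`. -/
abbrev FGSubmodules : Type u := {V : Submodule R N // V.FG ∧ V ≤ U}

instance : Nonempty (FGSubmodules U) := ⟨⟨⊥, Submodule.fg_bot, bot_le⟩⟩

instance : IsDirectedOrder (FGSubmodules U) :=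
  ⟨fun V W => ⟨⟨V.1 ⊔ W.1, V.2.1.sup W.2.1, sup_le V.2.2 W.2.2⟩, le_sup_left (a := V.1),
    le_sup_right (a := V.1)⟩⟩

theorem _root_.IsTorsionModule.quotient (hN : IsTorsionModule I N) (V : Submodule R N) :
    IsTorsionModule I (N ⧸ V) :=
  hN.of_surjective V.mkQ V.mkQ_surjective

/-- The diagram of the quotients of `N` by finitely generated submodules of `U`. -/
def quotientDiagram : FGSubmodules U ⥤ TorsionModuleCat I where
  obj V := of (N ⧸ V.1) (hN.quotient V.1)
  map {V W} h := ObjectProperty.homMk (ModuleCat.ofHom (Submodule.factor h.le))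
  map_id V := ObjectProperty.hom_ext _ (ModuleCat.hom_ext (by ext; rfl))
  map_comp f g := ObjectProperty.hom_ext _ (ModuleCat.hom_ext (by ext; rfl))

/-- The quotient `N ⧸ U` as a cocone over the quotients of `N` by finitely generated submodules
of `U`. -/
def quotientCocone : Cocone (quotientDiagram hN U) where
  pt := of (N ⧸ U) (hN.quotient U)
  ι :=
    { app := fun V => ObjectProperty.homMk (ModuleCat.ofHom (Submodule.factor V.2.2))
      naturality := fun V W h => by
        refine Eq.trans ?_ (Category.comp_id _).symm
        exact ObjectProperty.hom_ext _ (ModuleCat.hom_ext (Submodule.linearMap_qext _ rfl)) }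

/-- The quotient `N ⧸ U` is the filtered colimit of the quotients of `N` by finitely generated
submodules of `U`. -/
def isColimitQuotientCocone : IsColimit (quotientCocone hN U) where
  desc s := ObjectProperty.homMk (ModuleCat.ofHom (Submodule.liftQ U
    ((s.ι.app ⟨⊥, Submodule.fg_bot, bot_le⟩).hom.hom ∘ₗ Submodule.mkQ ⊥) (by
      intro x hx
      let V : FGSubmodules U := ⟨Submodule.span R {x}, Submodule.fg_span_singleton x, by
        simpa using hx⟩
      let b : FGSubmodules U := ⟨⊥, Submodule.fg_bot, bot_le⟩
      have hbV : b ≤ V := bot_le (a := V.1)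
      have h := LinearMap.congr_fun (congrArg (fun f => ModuleCat.Hom.hom
        (InducedCategory.Hom.hom f)) (s.w (homOfLE hbV))) (Submodule.Quotient.mk x)
      have h0 : (Submodule.Quotient.mk x : N ⧸ V.1) = 0 :=
        (Submodule.Quotient.mk_eq_zero _).2 (Submodule.mem_span_singleton_self x)
      exact h.symm.trans ((congrArg (s.ι.app V).hom.hom h0).trans (map_zero _)))))
  fac s V := by
    refine ObjectProperty.hom_ext _ (ModuleCat.hom_ext (LinearMap.ext fun x => ?_))
    obtain ⟨x, rfl⟩ := Submodule.mkQ_surjective _ x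
    let b : FGSubmodules U := ⟨⊥, Submodule.fg_bot, bot_le⟩
    have hbV : b ≤ V := bot_le (a := V.1)
    exact (LinearMap.congr_fun (congrArg (fun f => ModuleCat.Hom.hom
        (InducedCategory.Hom.hom f)) (s.w (homOfLE hbV))) (Submodule.Quotient.mk x)).symm
  uniq s m hm := by
    refine ObjectProperty.hom_ext _ (ModuleCat.hom_ext (LinearMap.ext fun x => ?_))
    obtain ⟨x, rfl⟩ := Submodule.mkQ_surjective _ x
    exact LinearMap.congr_fun (congrArg (fun f => ModuleCat.Hom.hom
        (InducedCategory.Hom.hom f)) (hm ⟨⊥, Submodule.fg_bot, bot_le⟩)) (Submodule.Quotient.mk x)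

end FilteredQuotients

/-- The quotients of `M` by finitely generated submodules have colimit zero, so the projection from
`M` dies at a finite stage. -/
theorem finite_of_isFinitelyPresentable (M : TorsionModuleCat I) [IsFinitelyPresentable.{u} M] :
    Module.Finite R M.obj := by
  let b : FGSubmodules (⊤ : Submodule R M.obj) := ⟨⊥, Submodule.fg_bot, bot_le⟩
  let p : M ⟶ (quotientDiagram M.property (⊤ : Submodule R M.obj)).obj b :=
    ObjectProperty.homMk (ModuleCat.ofHom (Submodule.mkQ ⊥))
  obtain ⟨V, u, v, h⟩ := IsFinitelyPresentable.exists_eq_of_isColimit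
    (isColimitQuotientCocone M.property (⊤ : Submodule R M.obj)) p 0
    (ObjectProperty.hom_ext _ (ModuleCat.hom_ext (LinearMap.ext fun x =>
      (Submodule.Quotient.mk_eq_zero _).2 trivial)))
  refine ⟨?_⟩
  have : V.1 = ⊤ := by
    rw [eq_top_iff]
    intro x _
    rw [← Submodule.Quotient.mk_eq_zero]
    have := LinearMap.congr_fun (congrArg (fun f => ModuleCat.Hom.hom
        (InducedCategory.Hom.hom f)) h) x
    rw [zero_comp] at this
    exact this
  exact this ▸ V.2.1

/-- The identity of `N/U` factors through some `N/V` with `V` finitely generated. A retract of a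
finitely presented module is finitely presented. -/
theorem finitePresentation_quotient {N : Type u} [AddCommGroup N] [Module R N]
    (hN : IsTorsionModule I N) [Module.FinitePresentation R N] (U : Submodule R N)
    [IsFinitelyPresentable.{u} (of (N ⧸ U) (hN.quotient U))] :
    Module.FinitePresentation R (N ⧸ U) := by
  obtain ⟨V, σ, h⟩ := IsFinitelyPresentable.exists_hom_of_isColimit
    (isColimitQuotientCocone hN U) (𝟙 (of (N ⧸ U) (hN.quotient U)))
  let p : (N ⧸ V.1) →ₗ[R] (N ⧸ U) := Submodule.factor V.2.2
  let s : (N ⧸ U) →ₗ[R] (N ⧸ V.1) := σ.hom.hom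
  have hps : ∀ x, p (s x) = x := LinearMap.congr_fun (congrArg (fun f => ModuleCat.Hom.hom
        (InducedCategory.Hom.hom f)) h)
  have : Module.FinitePresentation R (N ⧸ V.1) :=
    Module.finitePresentation_of_surjective V.1.mkQ V.1.mkQ_surjective
      (by rw [Submodule.ker_mkQ]; exact V.2.1)
  refine Module.finitePresentation_of_surjective p (fun x => ⟨s x, hps x⟩) ?_
  have hker : LinearMap.ker p = LinearMap.range (LinearMap.id - s ∘ₗ p) := by
    ext x
    constructor
    · intro hx
      exact ⟨x, by simp [LinearMap.mem_ker.1 hx]⟩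
    · rintro ⟨x, rfl⟩
      simp [hps]
  rw [hker, LinearMap.range_eq_map]
  exact (Module.Finite.fg_top).map _

theorem finitePresentation_of_isFinitelyPresentable (hI : I.FG) (M : TorsionModuleCat I)
    [IsFinitelyPresentable.{u} M] : Module.FinitePresentation R M.obj := by
  have := finite_of_isFinitelyPresentable M
  obtain ⟨k, hk⟩ := M.property.exists_pow_le_annihilator hI (N := ⊤) Module.Finite.fg_top
  obtain ⟨n, π, hπ⟩ := Module.Finite.exists_fin' R M.obj
  -- `M` is a quotient of `(R/Iᵏ)ⁿ`, which is both torsion and, `I` being finitely generated,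
  -- finitely presented.
  let E : Submodule R (Fin n → R) := I ^ k • ⊤
  let N := (Fin n → R) ⧸ E
  have hN : IsTorsionModule I N := isTorsionModule_of_pow_le (K := I ^ k) le_rfl fun r hr x => by
    obtain ⟨x, rfl⟩ := E.mkQ_surjective x
    rw [← map_smul, ← LinearMap.mem_ker, Submodule.ker_mkQ]
    exact Submodule.smul_mem_smul hr trivial
  have : Module.FinitePresentation R N :=
    Module.finitePresentation_of_surjective E.mkQ E.mkQ_surjective (by
      rw [Submodule.ker_mkQ]
      exact Submodule.FG.smul hI.pow Module.Finite.fg_top)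
  let q : N →ₗ[R] M.obj := Submodule.liftQ E π (by
    rw [Submodule.smul_le]
    intro r hr x _
    rw [LinearMap.mem_ker, map_smul]
    exact Submodule.mem_annihilator.1 (hk hr) _ trivial)
  have hq : Function.Surjective q := fun x => by
    obtain ⟨y, rfl⟩ := hπ x
    exact ⟨E.mkQ y, rfl⟩
  let e : (N ⧸ LinearMap.ker q) ≃ₗ[R] M.obj := q.quotKerEquivOfSurjective hq
  let e' : of (N ⧸ LinearMap.ker q) (hN.quotient _) ≅ M :=
    ObjectProperty.isoMk _ e.toModuleIso
  have : IsFinitelyPresentable.{u} (of (N ⧸ LinearMap.ker q) (hN.quotient _)) :=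
    have := Cardinal.fact_isRegular_aleph0
    isCardinalPresentable_of_iso e'.symm _
  have := finitePresentation_quotient hN (LinearMap.ker q)
  exact Module.FinitePresentation.of_equiv e

instance isClosedUnderColimitsOfShape_of_isFiltered (T : Type u) [SmallCategory T] [IsFiltered T] :
    (torsionProperty I).IsClosedUnderColimitsOfShape T where
  colimitsOfShape_le := by
    rintro X ⟨p⟩ s hs x
    obtain ⟨j, y, rfl⟩ := Concrete.isColimit_exists_rep p.diag p.isColimit x
    obtain ⟨n, hn, h⟩ := p.prop_diag_obj j s hs y
    exact ⟨n, hn, by rw [← map_smul, h, map_zero]⟩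

/-! ### Maps from finitely presented modules into filtered colimits of torsion modules -/

section FilteredColimits

variable {T : Type u} [SmallCategory T] [IsFiltered T] {F : T ⥤ TorsionModuleCat I}
  {c : Cocone F}

theorem exists_rep_of_isColimit (hc : IsColimit c) (x : c.pt.obj) :
    ∃ (j : T) (y : (F.obj j).obj), (c.ι.app j).hom.hom y = x :=
  Concrete.isColimit_exists_rep _ (isColimitOfPreserves (torsionProperty I).ι hc) x

theorem exists_map_eq_zero_of_isColimit (hc : IsColimit c) {j : T} {P : Type u} [AddCommGroup P]
    [Module R P] (φ : P →ₗ[R] (F.obj j).obj) {K : Submodule R P} (hK : K.FG)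
    (h : ∀ x ∈ K, (c.ι.app j).hom.hom (φ x) = 0) :
    ∃ (k : T) (f : j ⟶ k), ∀ x ∈ K, (F.map f).hom.hom (φ x) = 0 := by
  induction K, hK using Submodule.fg_induction with
  | singleton x =>
    obtain ⟨k, f, g, hfg⟩ := Concrete.isColimit_exists_of_rep_eq _
      (isColimitOfPreserves (torsionProperty I).ι hc) (φ x) (0 : (F.obj j).obj)
      ((h x (Submodule.mem_span_singleton_self x)).trans (map_zero _).symm)
    refine ⟨k, f, fun y hy => ?_⟩
    obtain ⟨r, rfl⟩ := Submodule.mem_span_singleton.1 hy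
    have : (F.map f).hom.hom (φ x) = 0 := hfg.trans (map_zero _)
    rw [map_smul, map_smul, this, smul_zero]
  | sup K₁ K₂ _ _ ih₁ ih₂ =>
    obtain ⟨k₁, f₁, h₁⟩ := ih₁ fun x hx => h x (Submodule.mem_sup_left hx)
    obtain ⟨k₂, f₂, h₂⟩ := ih₂ fun x hx => h x (Submodule.mem_sup_right hx)
    obtain ⟨k, g₁, g₂, hg⟩ := IsFiltered.span f₁ f₂
    refine ⟨k, f₁ ≫ g₁, fun x hx => ?_⟩
    obtain ⟨x₁, hx₁, x₂, hx₂, rfl⟩ := Submodule.mem_sup.1 hx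
    have e₁ : (F.map (f₁ ≫ g₁)).hom.hom (φ x₁) = 0 := by
      rw [F.map_comp]
      exact (congrArg (F.map g₁).hom.hom (h₁ x₁ hx₁)).trans (map_zero _)
    have e₂ : (F.map (f₁ ≫ g₁)).hom.hom (φ x₂) = 0 := by
      rw [hg, F.map_comp]
      exact (congrArg (F.map g₂).hom.hom (h₂ x₂ hx₂)).trans (map_zero _)
    rw [map_add, map_add, e₁, e₂, add_zero]

theorem exists_factorization_of_isColimit (hc : IsColimit c) {M : Type u} [AddCommGroup M]
    [Module R M] [Module.FinitePresentation R M] (h : M →ₗ[R] c.pt.obj) :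
    ∃ (j : T) (g : M →ₗ[R] (F.obj j).obj), ∀ x, (c.ι.app j).hom.hom (g x) = h x := by
  classical
  obtain ⟨n, π, hπ⟩ := Module.Finite.exists_fin' R M
  choose j y hy using fun i : Fin n => exists_rep_of_isColimit hc (h (π (Pi.single i 1)))
  obtain ⟨k, hk⟩ := IsFiltered.sup_objs_exists (Finset.univ.image j)
  let f (i : Fin n) : j i ⟶ k := (hk (Finset.mem_image_of_mem j (Finset.mem_univ i))).some
  let φ : (Fin n → R) →ₗ[R] (F.obj k).obj :=
    Fintype.linearCombination R fun i => (F.map (f i)).hom.hom (y i)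
  have hφ : (c.ι.app k).hom.hom ∘ₗ φ = h ∘ₗ π := by
    ext i
    have e : φ (Pi.single i 1) = (F.map (f i)).hom.hom (y i) := by
      simp [φ, Fintype.linearCombination_apply_single]
    simp only [LinearMap.comp_apply, LinearMap.single_apply, e, ← hy]
    exact LinearMap.congr_fun (congrArg (fun g => ModuleCat.Hom.hom
        (InducedCategory.Hom.hom g)) (c.w (f i))) (y i)
  obtain ⟨l, g, hg⟩ := exists_map_eq_zero_of_isColimit hc φ
    (Module.FinitePresentation.fg_ker π hπ) fun x hx => by
      have := LinearMap.congr_fun hφ x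
      simp only [LinearMap.comp_apply, LinearMap.mem_ker.1 hx, map_zero] at this
      exact this
  have hle : LinearMap.ker π ≤ LinearMap.ker ((F.map g).hom.hom ∘ₗ φ) := fun x hx => hg x hx
  let e := π.quotKerEquivOfSurjective hπ
  refine ⟨l, Submodule.liftQ _ _ hle ∘ₗ e.symm.toLinearMap, fun x => ?_⟩
  obtain ⟨x, rfl⟩ := hπ x
  have he : e.symm (π x) = Submodule.Quotient.mk x := by
    rw [LinearEquiv.symm_apply_eq]; rfl
  rw [LinearMap.comp_apply, LinearEquiv.coe_coe, he]
  exact (LinearMap.congr_fun (congrArg (fun g => ModuleCat.Hom.hom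
        (InducedCategory.Hom.hom g)) (c.w g)) (φ x)).trans (LinearMap.congr_fun hφ x)

end FilteredColimits

theorem isFinitelyPresentable_of_finitePresentation {M : Type u} [AddCommGroup M] [Module R M]
    [Module.FinitePresentation R M] (hM : IsTorsionModule I M) :
    IsFinitelyPresentable.{u} (of M hM) := by
  rw [isFinitelyPresentable_iff_preservesFilteredColimits]
  refine ⟨fun T _ _ => ⟨fun {F} => ⟨fun {c} hc => ⟨?_⟩⟩⟩⟩
  refine Types.FilteredColimit.isColimitOf' _ _ (fun h => ?_) fun j h h' hh => ?_
  · obtain ⟨j, g, hg⟩ := exists_factorization_of_isColimit (M := M) hc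
      (InducedCategory.Hom.hom h).hom
    exact ⟨j, ObjectProperty.homMk (ModuleCat.ofHom g),
      ObjectProperty.hom_ext _ (ModuleCat.hom_ext (LinearMap.ext fun x => (hg x).symm))⟩
  · have e (x : M) := LinearMap.congr_fun (congrArg (fun g => ModuleCat.Hom.hom
        (InducedCategory.Hom.hom g)) hh) x
    let φ : M →ₗ[R] (F.obj j).obj := h.hom.hom
    let φ' : M →ₗ[R] (F.obj j).obj := h'.hom.hom
    obtain ⟨k, f, hf⟩ := exists_map_eq_zero_of_isColimit (P := M) hc (φ - φ')
      (Module.Finite.fg_top) fun x _ => by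
        rw [LinearMap.sub_apply, map_sub, sub_eq_zero]
        exact e x
    refine ⟨k, f, ObjectProperty.hom_ext _ (ModuleCat.hom_ext (LinearMap.ext fun x => ?_))⟩
    have := hf x trivial
    rw [LinearMap.sub_apply, map_sub, sub_eq_zero] at this
    exact this

end TorsionModuleCat

/-! ### Injective torsion modules -/

section TorsionPart

variable {R : Type u} [CommRing R] (I : Ideal R)

/-- The submodule of `I`-torsion elements. -/
def torsionPart (M : Type u) [AddCommGroup M] [Module R M] : Submodule R M where
  carrier := {x | ∀ s ∈ I, ∃ n : ℕ, 1 ≤ n ∧ s ^ n • x = 0}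
  add_mem' {x y} hx hy s hs := by
    obtain ⟨m, hm, h⟩ := hx s hs
    obtain ⟨n, -, h'⟩ := hy s hs
    refine ⟨m + n, by omega, ?_⟩
    rw [smul_add, pow_add, mul_smul (s ^ m) (s ^ n) y, h', smul_zero, add_zero, mul_comm,
      mul_smul, h, smul_zero]
  zero_mem' s _ := ⟨1, le_rfl, smul_zero _⟩
  smul_mem' r x hx s hs := by
    obtain ⟨n, hn, h⟩ := hx s hs
    exact ⟨n, hn, by rw [smul_comm, h, smul_zero]⟩

theorem isTorsionModule_torsionPart (M : Type u) [AddCommGroup M] [Module R M] :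
    IsTorsionModule I (torsionPart I M) := fun s hs x => by
  obtain ⟨n, hn, h⟩ := x.2 s hs
  exact ⟨n, hn, Subtype.ext h⟩

variable {I}

theorem IsTorsionModule.apply_mem_torsionPart {M N : Type u} [AddCommGroup M] [Module R M]
    [AddCommGroup N] [Module R N] (hM : IsTorsionModule I M) (f : M →ₗ[R] N) (x : M) :
    f x ∈ torsionPart I N := fun s hs => by
  obtain ⟨n, hn, h⟩ := hM s hs x
  exact ⟨n, hn, by rw [← map_smul, h, map_zero]⟩

namespace TorsionModuleCat

/-- The module kernel is itself torsion, so its inclusion is a morphism of the category that a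
monomorphism must cancel. -/
theorem injective_of_mono {X Y : TorsionModuleCat I} (f : X ⟶ Y) [Mono f] :
    Function.Injective f.hom.hom := by
  rw [← LinearMap.ker_eq_bot, Submodule.eq_bot_iff]
  intro x hx
  let K := LinearMap.ker f.hom.hom
  let k : of K (X.property.of_injective K.subtype K.injective_subtype) ⟶ X :=
    ObjectProperty.homMk (ModuleCat.ofHom K.subtype)
  have hk : k = 0 := by
    rw [← cancel_mono f, Limits.zero_comp]
    exact ObjectProperty.hom_ext _ (ModuleCat.hom_ext (LinearMap.ext fun x => x.2))
  exact LinearMap.congr_fun (congrArg (fun g => ModuleCat.Hom.hom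
    (InducedCategory.Hom.hom g)) hk) (⟨x, hx⟩ : K)

instance injective_torsionPart (E : Type u) [AddCommGroup E] [Module R E] [Module.Injective R E] :
    Injective (of (torsionPart I E) (isTorsionModule_torsionPart I E)) where
  factors {X Y} g f _ := by
    obtain ⟨l, hl⟩ := Module.Injective.out f.hom.hom (injective_of_mono f)
      ((torsionPart I E).subtype ∘ₗ g.hom.hom)
    refine ⟨ObjectProperty.homMk (ModuleCat.ofHom
      (l.codRestrict _ fun y => Y.property.apply_mem_torsionPart l y)), ?_⟩
    exact ObjectProperty.hom_ext _ (ModuleCat.hom_ext (LinearMap.ext fun x => Subtype.ext (hl x)))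

end TorsionModuleCat

end TorsionPart

/-! ### fp-injective torsion modules -/

section FpInjective

theorem IsFpInjectiveTorsion.exists_extension {S : Type u} [CommRing S] {J : Ideal S} {K : Type u}
    [AddCommGroup K] [Module S K] (hK : IsFpInjectiveTorsion J K) {A B C : Type u} [AddCommGroup A]
    [AddCommGroup B] [AddCommGroup C] [Module S A] [Module S B] [Module S C]
    [Module.FinitePresentation S C] (hB : IsTorsionModule J B) (f : A →ₗ[S] B) (g : B →ₗ[S] C)
    (hf : Function.Injective f) (hfg : Function.Exact f g) (hg : Function.Surjective g)
    (φ : A →ₗ[S] K) : ∃ ψ : B →ₗ[S] K, ψ ∘ₗ f = φ := by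
  obtain ⟨hKt, hK⟩ := hK
  have hA : IsTorsionModule J A := hB.of_injective f hf
  have hC : IsTorsionModule J C := hB.of_surjective g hg
  have := hK _ (TorsionModuleCat.isFinitelyPresentable_of_finitePresentation hC)
  obtain ⟨w, h⟩ := TorsionModuleCat.shortExact_of_exact (hA := hA) (hB := hB) (hC := hC) f g hf
    hfg hg
  obtain ⟨ψ, hψ⟩ := Abelian.Ext.exists_extension_of_subsingleton h
    (Y := TorsionModuleCat.of K hKt) (ObjectProperty.homMk (ModuleCat.ofHom φ))
  exact ⟨ψ.hom.hom, congrArg (fun g => ModuleCat.Hom.hom (InducedCategory.Hom.hom g)) hψ⟩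

/-- A torsion module is fp-injective if linear maps to it extend from finitely generated
submodules of finitely generated torsion modules with finitely presented quotients. -/
theorem isFpInjectiveTorsion_of_exists_extension {R : Type u} [CommRing R] {I : Ideal R}
    (hI : I.FG) {K : Type u} [AddCommGroup K] [Module R K] (hK : IsTorsionModule I K)
    (h : ∀ (L : Type u) [AddCommGroup L] [Module R L] [Module.Finite R L] (N : Submodule R L),
      IsTorsionModule I L → Module.FinitePresentation R (L ⧸ N) →
        ∀ φ : N →ₗ[R] K, ∃ ψ : L →ₗ[R] K, ψ ∘ₗ N.subtype = φ) :
    IsFpInjectiveTorsion I K := by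
  refine ⟨hK, fun M hM => ?_⟩
  have hMfp := TorsionModuleCat.finitePresentation_of_isFinitelyPresentable hI M
  let E : ModuleCat.{u} R := Injective.under (ModuleCat.of R K)
  have : Injective (ModuleCat.of R E) := Injective.injective_under (ModuleCat.of R K)
  have : Module.Injective R E := Module.injective_module_of_injective_object R E
  let Q := torsionPart I E
  have hQ : IsTorsionModule I Q := isTorsionModule_torsionPart I E
  let i : K →ₗ[R] E := (Injective.ι (ModuleCat.of R K)).hom
  have hi : Function.Injective i := (ModuleCat.mono_iff_injective _).1 inferInstance
  let j : K →ₗ[R] Q := i.codRestrict _ fun x => hK.apply_mem_torsionPart i x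
  have hj : Function.Injective j := fun x y hxy => hi (congrArg Subtype.val hxy)
  let p : Q →ₗ[R] Q ⧸ LinearMap.range j := (LinearMap.range j).mkQ
  have hjp : Function.Exact j p := LinearMap.exact_map_mkQ_range j
  obtain ⟨w, hs⟩ := TorsionModuleCat.shortExact_of_exact (hA := hK) (hB := hQ)
    (hC := hQ.quotient _) j p hj hjp (Submodule.mkQ_surjective _)
  have : Subsingleton (Abelian.Ext M (TorsionModuleCat.of Q hQ) 1) :=
    Abelian.Ext.subsingleton_of_injective M _ 0
  refine Abelian.Ext.subsingleton_of_exists_lift hs fun g => ?_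
  let g' : M.obj →ₗ[R] Q ⧸ LinearMap.range j := g.hom.hom
  obtain ⟨n, π, hπ⟩ := Module.Finite.exists_fin' R M.obj
  obtain ⟨l, hl⟩ := Module.projective_lifting_property p (g' ∘ₗ π) (Submodule.mkQ_surjective _)
  -- Dividing by the common kernel of `π` and `l` embeds `L` into `M × Q`, so `L` is torsion as well
  -- as finitely generated, and both maps descend to it.
  let D : Submodule R (Fin n → R) := LinearMap.ker (π.prod l)
  let L := (Fin n → R) ⧸ D
  have hL : IsTorsionModule I L := by
    have : IsTorsionModule I (M.obj × Q) := fun s hs x => by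
      obtain ⟨a, ha, ha'⟩ := M.property s hs x.1
      obtain ⟨b, hb, hb'⟩ := hQ s hs x.2
      refine ⟨a + b, by omega, Prod.ext ?_ ?_⟩
      · rw [add_comm, pow_add, mul_smul, Prod.smul_fst, Prod.smul_fst, ha', smul_zero,
          Prod.fst_zero]
      · rw [pow_add, mul_smul, Prod.smul_snd, Prod.smul_snd, hb', smul_zero, Prod.snd_zero]
    exact this.of_injective (Submodule.liftQ D (π.prod l) le_rfl)
      (LinearMap.ker_eq_bot.1 (Submodule.ker_liftQ_eq_bot' _ _ rfl))
  have hDπ : D ≤ LinearMap.ker π := fun x hx => congrArg Prod.fst (LinearMap.mem_ker.1 hx)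
  have hDl : D ≤ LinearMap.ker l := fun x hx => congrArg Prod.snd (LinearMap.mem_ker.1 hx)
  let π' : L →ₗ[R] M.obj := Submodule.liftQ D π hDπ
  let l' : L →ₗ[R] Q := Submodule.liftQ D l hDl
  have hπ' : Function.Surjective π' := fun x => by
    obtain ⟨y, rfl⟩ := hπ x
    exact ⟨D.mkQ y, rfl⟩
  have hl' (x : L) : p (l' x) = g' (π' x) := by
    obtain ⟨x, rfl⟩ := D.mkQ_surjective x
    exact LinearMap.congr_fun hl x
  let N := LinearMap.ker π'
  let e : (L ⧸ N) ≃ₗ[R] M.obj := π'.quotKerEquivOfSurjective hπ'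
  have hfp : Module.FinitePresentation R (L ⧸ N) := Module.FinitePresentation.of_equiv e.symm
  let je := LinearEquiv.ofInjective j hj
  let φ : N →ₗ[R] K := je.symm.toLinearMap ∘ₗ
    (l' ∘ₗ N.subtype).codRestrict (LinearMap.range j) fun x => by
      rw [← Submodule.ker_mkQ (LinearMap.range j), LinearMap.mem_ker]
      exact (hl' x).trans (by rw [LinearMap.mem_ker.1 x.2, map_zero])
  have hφ (x : N) : j (φ x) = l' x := congrArg Subtype.val (je.apply_symm_apply _)
  obtain ⟨ψ, hψ⟩ := h L N hL hfp φ
  -- On `N` the lift `l'` takes values in `K`; subtracting the extension `ψ` makes it vanish on `N`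
  -- without altering its image in `Q/K`.
  let k : (L ⧸ N) →ₗ[R] Q := Submodule.liftQ N (l' - j ∘ₗ ψ) fun x hx => by
    rw [LinearMap.mem_ker, LinearMap.sub_apply, sub_eq_zero, ← hφ ⟨x, hx⟩, ← hψ]
    rfl
  refine ⟨ObjectProperty.homMk (ModuleCat.ofHom (k ∘ₗ e.symm.toLinearMap)),
    ObjectProperty.hom_ext _ (ModuleCat.hom_ext (LinearMap.ext fun x => ?_))⟩
  obtain ⟨x, rfl⟩ := hπ' x
  have he : e.symm (π' x) = Submodule.Quotient.mk x := by
    rw [LinearEquiv.symm_apply_eq]; rfl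
  change p (k (e.symm (π' x))) = g' (π' x)
  rw [he]
  change p (l' x - j (ψ x)) = _
  rw [map_sub, hl', hjp.apply_apply_eq_zero, sub_zero]

/-- Base change along a flat morphism of quotient rings preserves injectivity of maps between
modules over the quotient ring of the source. -/
theorem lTensor_quotient_injective {R S : Type u} [CommRing R] [CommRing S] [Algebra R S]
    {I : Ideal R} {J : Ideal S} {h : I ≤ J.comap (algebraMap R S)}
    (hf : (Ideal.quotientMap J (algebraMap R S) h).Flat) {N L : Type u} [AddCommGroup N]
    [AddCommGroup L] [Module R N] [Module R L] (hL : ∀ r ∈ I, ∀ x : L, r • x = 0)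
    (f : N →ₗ[R] L) (hfi : Function.Injective f) :
    Function.Injective (f.lTensor (S ⧸ J)) := by
  let A := R ⧸ I
  have tL : Module.IsTorsionBySet R L (I : Ideal R) := fun x r => hL r r.2 x
  have tN : Module.IsTorsionBySet R N (I : Ideal R) := fun x r =>
    hfi (by rw [map_smul, map_zero]; exact hL r r.2 _)
  let _ : Module A L := tL.module
  let _ : Module A N := tN.module
  have : IsScalarTower R A L := tL.isScalarTower
  have : IsScalarTower R A N := tN.isScalarTower
  let _ : Algebra A (S ⧸ J) := (Ideal.quotientMap J (algebraMap R S) h).toAlgebra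
  have : IsScalarTower R A (S ⧸ J) := IsScalarTower.of_algebraMap_eq fun r => rfl
  have : Module.Flat A (S ⧸ J) := hf
  have cN : TensorProduct.CompatibleSMul R A (S ⧸ J) N := ⟨fun a b n => by
    obtain ⟨r, rfl⟩ := Ideal.Quotient.mk_surjective a
    rw [← Ideal.Quotient.algebraMap_eq, algebraMap_smul, algebraMap_smul, TensorProduct.smul_tmul]⟩
  let f' : N →ₗ[A] L := f.extendScalarsOfSurjective Ideal.Quotient.mk_surjective
  let cN' : (S ⧸ J) ⊗[A] N ≃ₗ[R] (S ⧸ J) ⊗[R] N :=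
    TensorProduct.equivOfCompatibleSMul R A R (S ⧸ J) N
  let cL : (S ⧸ J) ⊗[R] L →ₗ[R] (S ⧸ J) ⊗[A] L :=
    TensorProduct.mapOfCompatibleSMul A R R (S ⧸ J) L
  rw [injective_iff_map_eq_zero]
  intro x hx
  obtain ⟨y, rfl⟩ := cN'.surjective x
  -- As `R → A` is surjective, tensoring over `R` or over `A` agrees, so injectivity is inherited
  -- from flatness over `A`.
  have hc : ∀ y, cL (f.lTensor (S ⧸ J) (cN' y)) = f'.lTensor (S ⧸ J) y := by
    intro y
    induction y with
    | zero => simp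
    | tmul b n => rfl
    | add a b ha hb => rw [map_add, map_add, map_add, map_add, ha, hb]
  have := hc y
  rw [hx, map_zero] at this
  rw [Module.Flat.lTensor_preserves_injective_linearMap f' hfi (this.symm.trans (map_zero _).symm),
    map_zero]

theorem IsFpInjectiveTorsion.restrictScalars {R S : Type u} [CommRing R] [CommRing S] [Algebra R S]
    {I : Ideal R} {J : Ideal S} (hI : I.FG) (hJ : J.FG) (hIJ : I.map (algebraMap R S) ≤ J)
    (hf : IsQuotflat (algebraMap R S) I J) {K : Type u} [AddCommGroup K] [Module S K] [Module R K]
    [IsScalarTower R S K] (hK : IsFpInjectiveTorsion J K) : IsFpInjectiveTorsion I K := by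
  have hKI : IsTorsionModule I K := fun r hr x => by
    obtain ⟨n, hn, h⟩ := hK.1 _ (hIJ (Ideal.mem_map_of_mem _ hr)) x
    exact ⟨n, hn, by rwa [← map_pow, algebraMap_smul] at h⟩
  refine isFpInjectiveTorsion_of_exists_extension hI hKI fun L _ _ _ N hL hfp φ => ?_
  have hN : N.FG := by
    have := Module.FinitePresentation.fg_ker N.mkQ N.mkQ_surjective
    rwa [Submodule.ker_mkQ] at this
  obtain ⟨I', J', hfg, -, hle, hge, hflat⟩ := hf
  obtain ⟨a, ha⟩ := hL.exists_pow_le_annihilator hI (N := ⊤) Module.Finite.fg_top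
  have hW : (Submodule.span S (Set.range φ)).FG := by
    have hφ : (LinearMap.range φ).FG := by
      rw [LinearMap.range_eq_map]
      exact Submodule.FG.map _ ((Submodule.fg_top N).2 hN)
    obtain ⟨t, ht⟩ := hφ
    refine ⟨t, le_antisymm (Submodule.span_le.2 fun x hx => Submodule.subset_span ?_)
      (Submodule.span_le.2 ?_)⟩
    · have : x ∈ LinearMap.range φ := ht ▸ Submodule.subset_span hx
      exact this
    · rintro x hx
      have h1 : x ∈ Submodule.span R (t : Set K) := by
        rw [ht]; exact hx
      exact Submodule.span_le_restrictScalars R S _ h1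
  obtain ⟨b, hb⟩ := hK.1.exists_pow_le_annihilator hJ hW
  -- `I'_m ⊆ Iᵃ` kills `L`, `J'_m ⊆ Jᵇ` kills the `S`-span of the image of `φ`, and `m` is at least
  -- `1`.
  let m := a + b + 1
  obtain ⟨q, -, -, hq⟩ := hge m (by omega)
  obtain ⟨hIm, hJm⟩ := hle m (by omega)
  obtain ⟨h, hfl⟩ := hflat m (by omega)
  let B := S ⧸ J' m
  let W := Submodule.span S (Set.range φ)
  have tW : Module.IsTorsionBySet S W (J' m : Ideal S) := fun x r => Subtype.ext
    (Submodule.mem_annihilator.1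
      (hb (Ideal.pow_le_pow_right (by omega : b ≤ m) (hJm r.2))) _ x.2)
  let _ : Module B W := tW.module
  have : IsScalarTower S B W := tW.isScalarTower
  have : IsScalarTower R B W := ⟨fun r c x => by
    rw [← algebraMap_smul S r c, smul_assoc, algebraMap_smul]⟩
  let φ' : N →ₗ[R] W :=
    { toFun := fun x => ⟨φ x, Submodule.subset_span ⟨x, rfl⟩⟩
      map_add' := fun x y => Subtype.ext (map_add φ x y)
      map_smul' := fun r x => Subtype.ext (map_smul φ r x) }
  let Φ : B ⊗[R] N →ₗ[S] K := W.subtype ∘ₗ (φ'.liftBaseChange B).restrictScalars S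
  have hBfp : Module.FinitePresentation S B :=
    Module.finitePresentation_of_surjective (Submodule.mkQ (J' m)) (Submodule.mkQ_surjective _)
      (by rw [Submodule.ker_mkQ]; exact (hfg m (by omega)).2)
  -- Finite presentation is kept by base change to `B`, and then descends to `S` because `J'_m` is
  -- finitely generated.
  have hCfp : Module.FinitePresentation S (B ⊗[R] (L ⧸ N)) :=
    Module.FinitePresentation.trans S _ B
  have hBL : IsTorsionModule J (B ⊗[R] L) := isTorsionModule_of_pow_le hq fun r hr x => by
    induction x with
    | zero => rw [smul_zero]
    | tmul c x =>
      rw [TensorProduct.smul_tmul', Algebra.smul_def, Ideal.Quotient.algebraMap_eq,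
        Ideal.Quotient.eq_zero_iff_mem.2 hr, zero_mul, TensorProduct.zero_tmul]
    | add x y hx hy => rw [smul_add, hx, hy, add_zero]
  obtain ⟨Ψ, hΨ⟩ := hK.exists_extension hBL
    (TensorProduct.AlgebraTensorModule.lTensor S B N.subtype)
    (TensorProduct.AlgebraTensorModule.lTensor S B N.mkQ)
    (lTensor_quotient_injective hfl (fun r hr x => Submodule.mem_annihilator.1
      (ha (Ideal.pow_le_pow_right (by omega : a ≤ m) (hIm hr))) _ trivial) _ N.injective_subtype)
    (lTensor_exact B (LinearMap.exact_subtype_mkQ N) N.mkQ_surjective)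
    (LinearMap.lTensor_surjective B N.mkQ_surjective) Φ
  refine ⟨Ψ.restrictScalars R ∘ₗ TensorProduct.mk R B L 1, LinearMap.ext fun x => ?_⟩
  have := LinearMap.congr_fun hΨ (1 ⊗ₜ x)
  refine this.trans ?_
  change ((φ'.liftBaseChange B (1 ⊗ₜ x) : W) : K) = φ x
  rw [LinearMap.liftBaseChange_tmul, one_smul]
  rfl

end FpInjective

end

theorem mainTheorem11 {R S : Type u} [CommRing R] [CommRing S] [Algebra R S]
    (I : Ideal R) (J : Ideal S) (hI : I.FG) (hJ : J.FG)
    (hIJ : I.map (algebraMap R S) ≤ J)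
    (hf : IsQuotflat (algebraMap R S) I J) (hR : IsAdicallyCoherent I) :
    (IsWeaklyProregular I →
      ∀ (F : Type u) [AddCommGroup F] [Module S F] [Module R F] [IsScalarTower R S F],
        IsQuotseparatedContramodule J F → IsContraflat J F → IsContraflat I F) ∧
    (∀ (K : Type u) [AddCommGroup K] [Module S K] [Module R K] [IsScalarTower R S K],
        IsFpInjectiveTorsion J K → IsFpInjectiveTorsion I K) :=
  ⟨fun _ _ _ _ _ _ hq hF => hF.restrictScalars hI hJ hIJ hf hR hq,
    fun _ _ _ _ _ hK => hK.restrictScalars hI hJ hIJ hf⟩
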